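/- Let $\alpha\in(1,2]$ and let $\rho$ be a non-trivial probability measure on $\mathbb{Z}_+=\{0,1,2,\dots\}$ (i.e. $\rho\neq\delta_1$) with mean one, in the domain of attraction of a stable distribution of index $\alpha$, meaning that $$\sum_{k\ge 0}\rho(k)\,s^k = s+(1-s)^{\alpha}L(1-s)\qquad\text{for all } s\in[0,1),$$ for some function $L$ that is slowly varying at $0^+$. For $n\ge 1$ let $\mathcal{T}^{(n)}$ be a Galton--Watson tree with offspring distribution $\rho$ conditioned on non-extinction at generation $n$, and let the reduced tree $\mathcal{T}^{*n}$ be the subtree formed by all vertices of $\mathcal{T}^{(n)}$ that have at least one descendant at generation $n$ (a vertex being a descendant of itself). For a finite rooted tree $\mathsf{t}$ of height at least $n$, let $\mathcal{C}_n(\mathsf{t})$ denote the effective conductance, with unit conductance on every edge, between an extra vertex $\partial$ and generation $n$ of $\mathsf{t}$ in the graph obtained from $\mathsf{t}$ by adding an edge between its root and $\partial$. Then for every $r\in(0,\alpha)$ there exists a constant $K=K(r,\rho)\ge 1$, depending only on $r$ and $\rho$, such that for every integer $n\ge 1$, $$\mathbb{E}\big[\mathcal{C}_n(\mathcal{T}^{*n})^{r}\big]\le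 \frac{K}{(n+1)^{r}}.$$ -/

import Mathlib

open MeasureTheory ProbabilityTheory Filter Topology
open scoped ENNReal

noncomputable section

namespace ReducedGW

/-! ### Effective conductance in a finite graph with unit conductances -/

/-- The total current flowing out of the vertex `x` when the potential is `v` and every edge of `G`
has unit conductance. -/
def current {V : Type*} (G : SimpleGraph V) (v : V → ℝ) (x : V) : ℝ :=
  ∑ᶠ y ∈ G.neighborSet x, (v x - v y)

/-- `v` is a potential (voltage) on `G` equal to `1` at `a`, equal to `0` on `Z`, and satisfying
Kirchhoff's node law (harmonicity) at every other vertex. -/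
structure IsUnitVoltage {V : Type*} (G : SimpleGraph V) (a : V) (Z : Set V) (v : V → ℝ) : Prop where
  source : v a = 1
  sink : ∀ z ∈ Z, v z = 0
  harmonic : ∀ x, x ≠ a → x ∉ Z → current G v x = 0

/-- The effective conductance between `a` and `Z` in the finite graph `G`: the strength of the
current flowing out of `a` when the potential is `1` at `a` and `0` on `Z`. The set below has
exactly one element, see `existsUnique_current`, and `sSup` selects it. -/
def effectiveConductance {V : Type*} (G : SimpleGraph V) (a : V) (Z : Set V) : ℝ :=
  sSup {c | ∃ v, IsUnitVoltage G a Z v ∧ current G v a = c}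

theorem current_eq_lapMatrix {V : Type*} [Fintype V] [DecidableEq V] (G : SimpleGraph V)
    [DecidableRel G.Adj] (v : V → ℝ) (x : V) :
    current G v x = (G.lapMatrix ℝ).mulVec v x := by
  have h : G.neighborSet x = ↑(G.neighborFinset x) := by simp
  rw [current, h, finsum_mem_coe_finset, SimpleGraph.lapMatrix_mulVec_apply,
    Finset.sum_sub_distrib]
  simp

theorem eq_of_adj_of_mul_current_eq_zero {V : Type*} [Finite V] (G : SimpleGraph V) (d : V → ℝ)
    (h : ∀ x, d x * current G d x = 0) {x y : V} (hxy : G.Adj x y) : d x = d y := by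
  classical
  have := Fintype.ofFinite V
  have h0 : Matrix.toLinearMap₂' ℝ (G.lapMatrix ℝ) d d = 0 := by
    rw [Matrix.toLinearMap₂'_apply']
    refine Finset.sum_eq_zero fun x _ => ?_
    rw [← current_eq_lapMatrix]
    exact h x
  exact (G.lapMatrix_toLinearMap₂'_apply'_eq_zero_iff_forall_adj ℝ d).1 h0 x y hxy

theorem current_eq_zero_of_forall_adj {V : Type*} (G : SimpleGraph V) (d : V → ℝ) (x : V)
    (h : ∀ y, G.Adj x y → d x = d y) : current G d x = 0 :=
  finsum_mem_eq_zero_of_forall_eq_zero fun y hy => sub_eq_zero.2 (h y hy)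

theorem current_sub {V : Type*} [Finite V] (G : SimpleGraph V) (v w : V → ℝ) (x : V) :
    current G (v - w) x = current G v x - current G w x := by
  classical
  have := Fintype.ofFinite V
  simp only [current_eq_lapMatrix, Matrix.mulVec_sub, Pi.sub_apply]

theorem exists_isUnitVoltage {V : Type*} [Finite V] (G : SimpleGraph V) (a : V) (Z : Set V)
    (ha : a ∉ Z) : ∃ v, IsUnitVoltage G a Z v := by
  classical
  have := Fintype.ofFinite V
  let R : Set V := {x | (x ≠ a ∧ x ∉ Z) ∧ ∃ b, (b = a ∨ b ∈ Z) ∧ G.Reachable x b}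
  let L : (V → ℝ) →ₗ[ℝ] (V → ℝ) := LinearMap.pi fun x =>
    if x ∈ R then (LinearMap.proj x).comp (Matrix.mulVecLin (G.lapMatrix ℝ))
    else LinearMap.proj x
  have hL1 : ∀ v x, x ∈ R → L v x = current G v x := by
    intro v x hx
    simp [L, hx, current_eq_lapMatrix]
  have hL2 : ∀ v x, x ∉ R → L v x = v x := by
    intro v x hx
    simp [L, hx]
  have hinj : Function.Injective L := by
    rw [← LinearMap.ker_eq_bot, LinearMap.ker_eq_bot']
    intro d hd
    have hout : ∀ x, x ∉ R → d x = 0 := fun x hx => by rw [← hL2 d x hx, hd]; rfl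
    have hadj : ∀ x y, G.Adj x y → d x = d y := fun x y hxy => by
      refine eq_of_adj_of_mul_current_eq_zero G d (fun x => ?_) hxy
      by_cases hx : x ∈ R
      · rw [← hL1 d x hx, hd]; simp
      · rw [hout x hx, zero_mul]
    funext x
    by_cases hx : x ∈ R
    · obtain ⟨-, b, hb, ⟨p⟩⟩ := hx
      have hbR : b ∉ R := fun h => hb.elim h.1.1 h.1.2
      have key : ∀ {x y : V}, G.Walk x y → d x = d y := by
        intro x y p
        induction p with
        | nil => rfl
        | cons h _ ih => exact (hadj _ _ h).trans ih
      rw [key p, hout b hbR]; rfl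
    · exact hout x hx
  obtain ⟨v, hv⟩ := (LinearMap.injective_iff_surjective.1 hinj) (Pi.single a 1)
  have haR : a ∉ R := fun h => h.1.1 rfl
  refine ⟨v, ?_, ?_, ?_⟩
  · rw [← hL2 v a haR, hv]; simp
  · intro z hz
    have hza : z ≠ a := fun h => ha (h ▸ hz)
    rw [← hL2 v z (fun h => h.1.2 hz), hv]; simp [hza]
  · intro x hxa hxZ
    by_cases hx : x ∈ R
    · rw [← hL1 v x hx, hv]; simp [hxa]
    · have hno : ∀ b, (b = a ∨ b ∈ Z) → ¬ G.Reachable x b := fun b hb hr =>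
        hx ⟨⟨hxa, hxZ⟩, b, hb, hr⟩
      have hx0 : v x = 0 := by rw [← hL2 v x hx, hv]; simp [hxa]
      refine current_eq_zero_of_forall_adj G v x fun y hy => ?_
      have hya : y ≠ a := fun h => hno y (Or.inl h) hy.reachable
      have hyR : y ∉ R := fun ⟨_, b, hb, hr⟩ => hno b hb (hy.reachable.trans hr)
      rw [hx0, ← hL2 v y hyR, hv]; simp [hya]

/-- The effective conductance is well defined in every finite graph. -/
theorem existsUnique_current {V : Type*} [Finite V] (G : SimpleGraph V) (a : V) (Z : Set V)
    (ha : a ∉ Z) : ∃! c : ℝ, ∃ v, IsUnitVoltage G a Z v ∧ current G v a = c := by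
  obtain ⟨v, hv⟩ := exists_isUnitVoltage G a Z ha
  refine ⟨current G v a, ⟨v, hv, rfl⟩, ?_⟩
  rintro c ⟨w, hw, rfl⟩
  have h : current G (w - v) a = 0 := by
    refine current_eq_zero_of_forall_adj G _ a fun y hy => ?_
    refine eq_of_adj_of_mul_current_eq_zero G _ (fun x => ?_) hy
    by_cases hxa : x = a
    · simp [hxa, hw.source, hv.source]
    by_cases hxZ : x ∈ Z
    · simp [hw.sink x hxZ, hv.sink x hxZ]
    · rw [current_sub, hw.harmonic x hxa hxZ, hv.harmonic x hxa hxZ]; simp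
  rw [current_sub] at h
  linarith

/-! ### Trees as sets of words -/

/-- The graph obtained from the tree `t` (a set of words over the positive integers) by adding an
edge between the root (the empty word) and an extra vertex, represented by `none`. The edges inside
`t` join each nonempty word `u ++ [j]` of `t` to its parent `u`. -/
def augmentedGraph (t : Set (List ℕ)) : SimpleGraph (Option t) :=
  SimpleGraph.fromRel fun x y => match x, y with
    | none, some v => (v : List ℕ) = []
    | some u, some v => ∃ j : ℕ, (v : List ℕ) = u ++ [j]
    | _, none => False

/-- The conductance `C_i(t)` of a finite tree `t`: the effective conductance between the extra
vertex and generation `i` of `t` in the augmented graph. -/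
def conductance (i : ℕ) (t : Set (List ℕ)) : ℝ :=
  effectiveConductance (augmentedGraph t) none {x | ∃ u : t, x = some u ∧ (u : List ℕ).length = i}

/-- The plane tree in which the vertex `v` has `k v` children `v ++ [1], …, v ++ [k v]`. -/
def planeTree (k : List ℕ → ℕ) : Set (List ℕ) :=
  {u | ∀ v j, v ++ [j] <+: u → 1 ≤ j ∧ j ≤ k v}

/-- The vertices of the tree that have at least one descendant at generation `n`. -/
def reducedTree (n : ℕ) (k : List ℕ → ℕ) : Set (List ℕ) :=
  {u | u ∈ planeTree k ∧ ∃ w ∈ planeTree k, w.length = n ∧ u <+: w}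

theorem append_singleton_mem_planeTree (k : List ℕ → ℕ) (u : List ℕ) (j : ℕ) :
    u ++ [j] ∈ planeTree k ↔ u ∈ planeTree k ∧ 1 ≤ j ∧ j ≤ k u := by
  constructor
  · intro h
    exact ⟨fun v i hv => h v i (hv.trans (List.prefix_append u [j])), h u j List.prefix_rfl⟩
  · rintro ⟨hu, hj⟩ v i hv
    rcases List.prefix_concat_iff.1 hv with h | h
    · obtain ⟨rfl, h2⟩ := List.append_inj' h rfl
      obtain rfl : i = j := by simpa using h2
      exact hj
    · exact hu v i h

theorem finite_planeTree_generation (k : List ℕ → ℕ) (n : ℕ) :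
    {u | u ∈ planeTree k ∧ u.length = n}.Finite := by
  induction n with
  | zero =>
    refine (Set.finite_singleton ([] : List ℕ)).subset ?_
    rintro u ⟨-, hu⟩
    exact List.eq_nil_of_length_eq_zero hu
  | succ n ih =>
    refine (ih.biUnion fun u _ => (Set.finite_Iic (k u)).image fun j => u ++ [j]).subset ?_
    rintro u ⟨hu, hn⟩
    rcases List.eq_nil_or_concat' u with rfl | ⟨v, j, rfl⟩
    · simp at hn
    · have h := (append_singleton_mem_planeTree k v j).1 hu
      simp only [Set.mem_iUnion, Set.mem_image]
      exact ⟨v, ⟨h.1, by simpa using hn⟩, j, h.2.2, rfl⟩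

/-- The reduced tree is finite, so that its conductance is well defined. -/
theorem finite_reducedTree (n : ℕ) (k : List ℕ → ℕ) : (reducedTree n k).Finite := by
  refine ((Set.finite_Iic n).biUnion fun m _ => finite_planeTree_generation k m).subset ?_
  rintro u ⟨hu, w, -, hw, huw⟩
  simp only [Set.mem_iUnion]
  exact ⟨u.length, hw ▸ huw.length_le, hu, rfl⟩

/-! ### Critical Galton–Watson trees -/

/-- The law of the family of offspring numbers of a Galton–Watson tree with offspring distribution
`ρ`: the numbers attached to the words are independent with law `ρ`. The Galton–Watson tree is
`planeTree k`, for `k` distributed according to this law. -/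
def gwLaw (ρ : PMF ℕ) : Measure (List ℕ → ℕ) :=
  Measure.infinitePi fun _ : List ℕ => ρ.toMeasure

/-- The event that the tree is not extinct at generation `n`. -/
def survives (n : ℕ) : Set (List ℕ → ℕ) :=
  {k | ∃ u ∈ planeTree k, u.length = n}

/-- The Galton–Watson law conditioned on non-extinction at generation `n`. -/
def conditionedGWLaw (ρ : PMF ℕ) (n : ℕ) : Measure (List ℕ → ℕ) :=
  ProbabilityTheory.cond (gwLaw ρ) (survives n)

/-- `L` is slowly varying at `0+`. -/
structure SlowlyVaryingAtZero (L : ℝ → ℝ) : Prop where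
  measurable : Measurable L
  eventually_pos : ∀ᶠ x in 𝓝[>] (0 : ℝ), 0 < L x
  tendsto : ∀ c : ℝ, 0 < c → Tendsto (fun x => L (c * x) / L x) (𝓝[>] 0) (𝓝 1)

/-- The (mean one) distribution `ρ` is in the domain of attraction of a stable distribution of
index `α`, expressed on its generating function. -/
def InStableDomain (ρ : PMF ℕ) (α : ℝ) : Prop :=
  ∃ L : ℝ → ℝ, SlowlyVaryingAtZero L ∧
    ∀ s : ℝ, 0 ≤ s → s < 1 →
      ∑' k : ℕ, (ρ k).toReal * s ^ k = s + (1 - s) ^ α * L (1 - s)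

end ReducedGW

end

namespace ReducedGW

/-! ### Dirichlet's principle -/

/-! By Dirichlet's principle any test potential bounds the conductance from above. A potential
decreasing linearly from `∂` to generation `m ≤ n` has energy at most the number of vertices up to
generation `m`, over `(m + 1) ^ 2`. Generation sizes of the reduced tree are nondecreasing up to
`n`, so the conductance is at most `Z / (m + 1)`, where `Z` is the size of generation `m`
(`conductance_reducedTree_le`). With `m` about `n / 2`, it remains to bound the unconditioned moment
`E[Z ^ r]` by a constant times the survival probability `q_n`, which conditioning divides out.

Write the conjugate generating function as `g v = 1 - f (1 - v) = v - G v`, so that `q_n = g^n 1`.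
With `n = m + l`, the branching property gives `E[(1 - t) ^ Z] = 1 - g^m (t q_l)`
(`integral_pow_levelCount`). Up to the event `Z ≠ 0`, the power `Z ^ r` is dominated by a sum over
`t = 2^(-i)` of `2 ^ (i r)` times the second differences `1 - 2 (1 - t/2) ^ Z + (1 - t) ^ Z`
(`lintegral_rpow_le`), whose means are at most `m G(t q_l)`.

Two facts on `G` conclude. Regular variation and convexity give `G (c v) ≤ C c ^ s G v` with `r < s
< α` (`exists_forall_le_rpow`, `le_mul_rpow`), so the sum over scales is geometric, of order `m
G(q_l)`. The same scaling along the orbit of `1` gives `m G(q_l) ≤ D q_{m+l}` when `m ≤ l`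
(`exists_nat_mul_le_iterate_add`). -/

theorem effectiveConductance_eq_current {V : Type*} [Finite V] {G : SimpleGraph V} {a : V}
    {Z : Set V} (ha : a ∉ Z) {v : V → ℝ} (hv : IsUnitVoltage G a Z v) :
    effectiveConductance G a Z = current G v a := by
  obtain ⟨c, -, hc⟩ := existsUnique_current G a Z ha
  have h : {c | ∃ v, IsUnitVoltage G a Z v ∧ current G v a = c} = {current G v a} := by
    ext d
    constructor
    · intro hd
      rw [Set.mem_singleton_iff, hc d hd, hc _ ⟨v, hv, rfl⟩]
    · rintro rfl
      exact ⟨v, hv, rfl⟩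
  rw [effectiveConductance, h, csSup_singleton]

theorem toLinearMap₂'_lapMatrix_nonneg {V : Type*} [Fintype V] [DecidableEq V] (G : SimpleGraph V)
    [DecidableRel G.Adj] (w : V → ℝ) : 0 ≤ Matrix.toLinearMap₂' ℝ (G.lapMatrix ℝ) w w := by
  rw [SimpleGraph.lapMatrix_toLinearMap₂']
  refine div_nonneg (Finset.sum_nonneg fun x _ => Finset.sum_nonneg fun y _ => ?_) zero_le_two
  split_ifs <;> positivity

theorem toLinearMap₂'_lapMatrix_apply {V : Type*} [Fintype V] [DecidableEq V] (G : SimpleGraph V)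
    [DecidableRel G.Adj] (w v : V → ℝ) :
    Matrix.toLinearMap₂' ℝ (G.lapMatrix ℝ) w v = ∑ x, w x * current G v x := by
  simp only [Matrix.toLinearMap₂'_apply', current_eq_lapMatrix, dotProduct]

theorem toLinearMap₂'_lapMatrix_comm {V : Type*} [Fintype V] [DecidableEq V] (G : SimpleGraph V)
    [DecidableRel G.Adj] (w v : V → ℝ) :
    Matrix.toLinearMap₂' ℝ (G.lapMatrix ℝ) w v = Matrix.toLinearMap₂' ℝ (G.lapMatrix ℝ) v w := by
  rw [Matrix.toLinearMap₂'_apply', Matrix.toLinearMap₂'_apply', Matrix.dotProduct_mulVec,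
    ← Matrix.mulVec_transpose, (G.isSymm_lapMatrix (R := ℝ)).eq, dotProduct_comm]

theorem IsUnitVoltage.current_eq_energy {V : Type*} [Fintype V] [DecidableEq V]
    {G : SimpleGraph V} [DecidableRel G.Adj] {a : V} {Z : Set V} {v : V → ℝ}
    (hv : IsUnitVoltage G a Z v) :
    current G v a = Matrix.toLinearMap₂' ℝ (G.lapMatrix ℝ) v v := by
  rw [toLinearMap₂'_lapMatrix_apply, Finset.sum_eq_single a]
  · rw [hv.source, one_mul]
  · intro x _ hx
    by_cases hxZ : x ∈ Z
    · rw [hv.sink x hxZ, zero_mul]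
    · rw [hv.harmonic x hx hxZ, mul_zero]
  · simp

theorem effectiveConductance_nonneg {V : Type*} [Finite V] (G : SimpleGraph V) {a : V} {Z : Set V}
    (ha : a ∉ Z) : 0 ≤ effectiveConductance G a Z := by
  classical
  have := Fintype.ofFinite V
  obtain ⟨v, hv⟩ := exists_isUnitVoltage G a Z ha
  rw [effectiveConductance_eq_current ha hv, hv.current_eq_energy]
  exact toLinearMap₂'_lapMatrix_nonneg G v

/-- If `v` is the unit voltage, `w - v` vanishes at `a` and on `Z`, while the current of `v`
vanishes elsewhere. So `w - v` is orthogonal to `v` for the Laplacian form, and the energy of `w` is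
that of `v` plus that of `w - v`. -/
theorem effectiveConductance_le_energy {V : Type*} [Fintype V] [DecidableEq V] (G : SimpleGraph V)
    [DecidableRel G.Adj] {a : V} {Z : Set V} (ha : a ∉ Z) {w : V → ℝ} (hwa : w a = 1)
    (hwZ : ∀ z ∈ Z, w z = 0) :
    effectiveConductance G a Z ≤ Matrix.toLinearMap₂' ℝ (G.lapMatrix ℝ) w w := by
  obtain ⟨v, hv⟩ := exists_isUnitVoltage G a Z ha
  rw [effectiveConductance_eq_current ha hv, hv.current_eq_energy]
  have h0 : Matrix.toLinearMap₂' ℝ (G.lapMatrix ℝ) (w - v) v = 0 := by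
    rw [toLinearMap₂'_lapMatrix_apply]
    refine Finset.sum_eq_zero fun x _ => ?_
    by_cases hxa : x = a
    · simp [hxa, hwa, hv.source]
    by_cases hxZ : x ∈ Z
    · simp [hwZ x hxZ, hv.sink x hxZ]
    · rw [hv.harmonic x hxa hxZ, mul_zero]
  have h1 := toLinearMap₂'_lapMatrix_nonneg G (w - v)
  have h2 := toLinearMap₂'_lapMatrix_comm G w v
  simp only [map_sub, LinearMap.sub_apply] at h0 h1
  linarith

/-! ### Conductance of a tree and number of vertices -/

theorem conductance_nonneg {t : Set (List ℕ)} (ht : t.Finite) (n : ℕ) : 0 ≤ conductance n t := by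
  have := ht.to_subtype
  exact effectiveConductance_nonneg _ (by simp)

theorem conductance_le_card_div {t : Set (List ℕ)} (ht : t.Finite) {m n : ℕ} (hmn : m ≤ n) :
    conductance n t ≤
      ((ht.toFinset.filter fun u => u.length ≤ m).card : ℝ) / ((m : ℝ) + 1) ^ 2 := by
  classical
  have := ht.fintype
  have hm : (0 : ℝ) < (m : ℝ) + 1 := by positivity
  -- The potential drops by `1 / (m + 1)` per edge; truncated subtraction keeps it at `0` from
  -- generation `m` on, hence on generation `n`.
  let w : Option t → ℝ := fun x => x.elim 1 fun u => ((m - (u : List ℕ).length : ℕ) : ℝ) / (m + 1)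
  let g : Option t → ℝ := fun x =>
    x.elim 0 fun u => (if (u : List ℕ).length ≤ m then 1 else 0) / ((m : ℝ) + 1) ^ 2
  have hg : ∀ x, 0 ≤ g x := by
    rintro (_ | u)
    · exact le_rfl
    · simp only [g, Option.elim]
      split_ifs <;> positivity
  -- Edges are oriented from parent to child. A vertex has at most one parent (`huniq`), so the
  -- energy of each edge can be charged to its child through `g`.
  let P : Option t → Option t → Prop := fun x y => match x, y with
    | none, some v => (v : List ℕ) = []
    | some u, some v => ∃ j : ℕ, (v : List ℕ) = u ++ [j]
    | _, none => False
  have hP : ∀ x y, (augmentedGraph t).Adj x y → P x y ∨ P y x := by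
    intro x y h
    exact ((SimpleGraph.fromRel_adj _ _ _).1 h).2
  have hdiff : ∀ x y, P x y → (w x - w y) ^ 2 ≤ g y := by
    rintro (_ | u) (_ | v) h
    · exact h.elim
    · have hv : (v : List ℕ) = [] := h
      simp only [w, g, Option.elim, hv]
      simp only [List.length_nil, tsub_zero, zero_le, if_true]
      refine le_of_eq ?_
      field_simp
      ring
    · exact h.elim
    · obtain ⟨j, hv⟩ : ∃ j : ℕ, (v : List ℕ) = u ++ [j] := h
      simp only [w, g, Option.elim, hv, List.length_append, List.length_singleton]
      split_ifs with hl
      · rw [Nat.cast_sub hl, Nat.cast_sub (by omega)]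
        push_cast
        refine le_of_eq ?_
        field_simp
        ring
      · rw [Nat.sub_eq_zero_of_le (by omega), Nat.sub_eq_zero_of_le (by omega)]
        simp
  have huniq : ∀ x x' y, P x y → P x' y → x = x' := by
    rintro (_ | u) (_ | u') (_ | v) h h'
    any_goals first | exact h.elim | rfl
    · obtain ⟨j, hj⟩ : ∃ j : ℕ, (v : List ℕ) = u' ++ [j] := h'
      have h0 : (v : List ℕ) = [] := h
      simp [h0] at hj
    · obtain ⟨j, hj⟩ : ∃ j : ℕ, (v : List ℕ) = u ++ [j] := h
      have h0 : (v : List ℕ) = [] := h'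
      simp [h0] at hj
    · obtain ⟨j, hj⟩ : ∃ j : ℕ, (v : List ℕ) = u ++ [j] := h
      obtain ⟨j', hj'⟩ : ∃ j : ℕ, (v : List ℕ) = u' ++ [j] := h'
      rw [hj] at hj'
      exact congrArg some (Subtype.ext (List.append_inj' hj' rfl).1)
  have hsum : ∀ y, ∑ x, (if P x y then (w x - w y) ^ 2 else 0) ≤ g y := by
    intro y
    rw [← Finset.sum_filter]
    refine (Finset.sum_le_card_nsmul _ _ (g y) fun x hx => ?_).trans ?_
    · exact hdiff x y (Finset.mem_filter.1 hx).2
    · rw [nsmul_eq_mul]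
      refine mul_le_of_le_one_left (hg y) ?_
      exact_mod_cast Finset.card_le_one.2 fun x hx x' hx' =>
        huniq x x' y (Finset.mem_filter.1 hx).2 (Finset.mem_filter.1 hx').2
  -- The Laplacian form is half the sum over ordered pairs; the two orientations of each edge
  -- compensate the half.
  have hE : Matrix.toLinearMap₂' ℝ ((augmentedGraph t).lapMatrix ℝ) w w ≤ ∑ y, g y := by
    rw [SimpleGraph.lapMatrix_toLinearMap₂', div_le_iff₀ zero_lt_two]
    calc ∑ x, ∑ y, (if (augmentedGraph t).Adj x y then (w x - w y) ^ 2 else 0)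
        ≤ ∑ x, ∑ y, ((if P x y then (w x - w y) ^ 2 else 0)
            + (if P y x then (w y - w x) ^ 2 else 0)) := by
          refine Finset.sum_le_sum fun x _ => Finset.sum_le_sum fun y _ => ?_
          have h1 : 0 ≤ (w x - w y) ^ 2 := sq_nonneg _
          have h2 : (w y - w x) ^ 2 = (w x - w y) ^ 2 := by ring
          rw [h2]
          have := hP x y
          split_ifs <;> first | linarith | tauto
      _ = ∑ y, ∑ x, (if P x y then (w x - w y) ^ 2 else 0)
            + ∑ y, ∑ x, (if P x y then (w x - w y) ^ 2 else 0) := by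
          simp only [Finset.sum_add_distrib]
          rw [Finset.sum_comm]
      _ ≤ ∑ y, g y + ∑ y, g y :=
          add_le_add (Finset.sum_le_sum fun y _ => hsum y) (Finset.sum_le_sum fun y _ => hsum y)
      _ = (∑ y, g y) * 2 := by ring
  have hw : conductance n t ≤ Matrix.toLinearMap₂' ℝ ((augmentedGraph t).lapMatrix ℝ) w w := by
    refine effectiveConductance_le_energy _ (by simp) rfl ?_
    rintro z ⟨u, rfl, hu⟩
    simp [w, hu, Nat.sub_eq_zero_of_le hmn]
  refine hw.trans (hE.trans (le_of_eq ?_))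
  rw [Fintype.sum_option]
  simp only [g, Option.elim, zero_add]
  rw [← Finset.sum_div, Finset.card_filter, Nat.cast_sum]
  simp only [Nat.cast_ite, Nat.cast_one, Nat.cast_zero]
  congr 1
  exact (Finset.sum_subtype ht.toFinset (fun _ => ht.mem_toFinset)
    fun u => if u.length ≤ m then (1 : ℝ) else 0).symm

/-! ### Generations of the reduced tree -/

/-- The number of vertices of generation `m` that have a descendant at generation `n`. -/
noncomputable def levelCount (m n : ℕ) (k : List ℕ → ℕ) : ℕ :=
  ((finite_reducedTree n k).toFinset.filter fun u => u.length = m).card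

/-- The family of offspring numbers of the subtree of descendants of the vertex `[j]`. -/
def shift (j : ℕ) (k : List ℕ → ℕ) : List ℕ → ℕ := fun u => k (j :: u)

theorem mem_planeTree_of_prefix {k : List ℕ → ℕ} {u w : List ℕ} (hw : w ∈ planeTree k)
    (h : u <+: w) : u ∈ planeTree k :=
  fun v j hv => hw v j (hv.trans h)

theorem nil_mem_planeTree (k : List ℕ → ℕ) : [] ∈ planeTree k := by
  intro v j h
  simp at h

theorem cons_mem_planeTree {k : List ℕ → ℕ} {j : ℕ} {u : List ℕ} :
    j :: u ∈ planeTree k ↔ j ∈ Finset.Icc 1 (k []) ∧ u ∈ planeTree (shift j k) := by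
  rw [Finset.mem_Icc]
  constructor
  · intro h
    refine ⟨h [] j ⟨u, rfl⟩, fun v i hv => h (j :: v) i ?_⟩
    rw [List.cons_append, List.cons_prefix_cons]
    exact ⟨rfl, hv⟩
  · rintro ⟨hj, hu⟩ (_ | ⟨c, v⟩) i hv
    · rw [List.nil_append, List.cons_prefix_cons] at hv
      rw [hv.1]
      exact hj
    · rw [List.cons_append, List.cons_prefix_cons] at hv
      obtain ⟨rfl, hv⟩ := hv
      exact hu v i hv

theorem cons_mem_reducedTree {k : List ℕ → ℕ} {n j : ℕ} {u : List ℕ} :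
    j :: u ∈ reducedTree (n + 1) k ↔ j ∈ Finset.Icc 1 (k []) ∧ u ∈ reducedTree n (shift j k) := by
  constructor
  · rintro ⟨hu, w, hw, hwn, huw⟩
    rcases w with _ | ⟨c, w⟩
    · simp at hwn
    · rw [List.cons_prefix_cons] at huw
      obtain ⟨rfl, huw⟩ := huw
      rw [cons_mem_planeTree] at hu hw
      exact ⟨hu.1, hu.2, w, hw.2, by simpa using hwn, huw⟩
  · rintro ⟨hj, hu, w, hw, hwn, huw⟩
    exact ⟨cons_mem_planeTree.2 ⟨hj, hu⟩, j :: w, cons_mem_planeTree.2 ⟨hj, hw⟩, by simpa using hwn,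
      List.cons_prefix_cons.2 ⟨rfl, huw⟩⟩

theorem survives_zero : survives 0 = Set.univ :=
  Set.eq_univ_of_forall fun k => ⟨[], nil_mem_planeTree k, rfl⟩

theorem mem_survives_succ {k : List ℕ → ℕ} {n : ℕ} :
    k ∈ survives (n + 1) ↔ ∃ j ∈ Finset.Icc 1 (k []), shift j k ∈ survives n := by
  constructor
  · rintro ⟨_ | ⟨j, u⟩, hu, hn⟩
    · simp at hn
    · rw [cons_mem_planeTree] at hu
      exact ⟨j, hu.1, u, hu.2, by simpa using hn⟩
  · rintro ⟨j, hj, u, hu, hn⟩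
    exact ⟨j :: u, cons_mem_planeTree.2 ⟨hj, hu⟩, by simpa using hn⟩

theorem levelCount_succ (m n : ℕ) (k : List ℕ → ℕ) :
    levelCount (m + 1) (n + 1) k = ∑ j ∈ Finset.Icc 1 (k []), levelCount m n (shift j k) := by
  classical
  have h : (finite_reducedTree (n + 1) k).toFinset.filter (fun u => u.length = m + 1) =
      (Finset.Icc 1 (k [])).biUnion fun j =>
        ((finite_reducedTree n (shift j k)).toFinset.filter fun u => u.length = m).image
          (List.cons j) := by
    ext u
    simp only [Finset.mem_filter, Set.Finite.mem_toFinset, Finset.mem_biUnion, Finset.mem_image]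
    constructor
    · rintro ⟨hu, hm⟩
      rcases u with _ | ⟨j, u⟩
      · simp at hm
      · rw [cons_mem_reducedTree] at hu
        exact ⟨j, hu.1, u, ⟨hu.2, by simpa using hm⟩, rfl⟩
    · rintro ⟨j, hj, u, ⟨hu, hm⟩, rfl⟩
      exact ⟨cons_mem_reducedTree.2 ⟨hj, hu⟩, by simpa using hm⟩
  rw [levelCount, h, Finset.card_biUnion]
  · refine Finset.sum_congr rfl fun j _ => ?_
    rw [Finset.card_image_of_injective _ List.cons_injective, levelCount]
  · intro i _ j _ hij
    rw [Function.onFun, Finset.disjoint_left]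
    intro u hu hu'
    obtain ⟨v, -, rfl⟩ := Finset.mem_image.1 hu
    obtain ⟨v', -, h'⟩ := Finset.mem_image.1 hu'
    exact hij (List.cons.inj h').1.symm

open Classical in
theorem levelCount_zero (n : ℕ) (k : List ℕ → ℕ) :
    levelCount 0 n k = if k ∈ survives n then 1 else 0 := by
  split_ifs with h
  · obtain ⟨w, hw, hn⟩ := h
    refine Finset.card_eq_one.2 ⟨[], ?_⟩
    ext u
    simp only [Finset.mem_filter, Set.Finite.mem_toFinset, Finset.mem_singleton,
      List.length_eq_zero_iff]
    refine ⟨fun h => h.2, ?_⟩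
    rintro rfl
    exact ⟨⟨nil_mem_planeTree k, w, hw, hn, List.nil_prefix⟩, rfl⟩
  · refine Finset.card_eq_zero.2 (Finset.filter_eq_empty_iff.2 fun u hu _ => h ?_)
    obtain ⟨-, w, hw, hn, -⟩ := (finite_reducedTree n k).mem_toFinset.1 hu
    exact ⟨w, hw, hn⟩

theorem mem_survives_of_levelCount_ne_zero {m n : ℕ} {k : List ℕ → ℕ} (h : levelCount m n k ≠ 0) :
    k ∈ survives n := by
  obtain ⟨u, hu⟩ := Finset.card_ne_zero.1 h
  obtain ⟨-, w, hw, hn, -⟩ := (finite_reducedTree n k).mem_toFinset.1 (Finset.mem_filter.1 hu).1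
  exact ⟨w, hw, hn⟩

/-- Every vertex of generation `i` has a descendant at `n ≥ m`, whose ancestor at generation `m` is
mapped to it by truncation: `List.take i` is onto. -/
theorem levelCount_mono {i m n : ℕ} (him : i ≤ m) (hmn : m ≤ n) (k : List ℕ → ℕ) :
    levelCount i n k ≤ levelCount m n k := by
  classical
  refine (Finset.card_le_card ?_).trans (Finset.card_image_le (f := List.take i))
  intro u hu
  simp only [Finset.mem_filter, Set.Finite.mem_toFinset, Finset.mem_image] at hu ⊢
  obtain ⟨⟨-, w, hw, hn, huw⟩, rfl⟩ := hu
  refine ⟨w.take m, ⟨⟨mem_planeTree_of_prefix hw (List.take_prefix m w), w, hw, hn,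
    List.take_prefix m w⟩, ?_⟩, ?_⟩
  · rw [List.length_take]
    omega
  · rw [List.take_take, min_eq_left him, ← List.prefix_iff_eq_take.1 huw]

theorem conductance_reducedTree_le {m n : ℕ} (hmn : m ≤ n) (k : List ℕ → ℕ) :
    conductance n (reducedTree n k) ≤ (levelCount m n k : ℝ) / ((m : ℝ) + 1) := by
  have hm : (0 : ℝ) < (m : ℝ) + 1 := by positivity
  refine (conductance_le_card_div (finite_reducedTree n k) hmn).trans ?_
  have hc : ((finite_reducedTree n k).toFinset.filter fun u => u.length ≤ m).card
      ≤ (m + 1) * levelCount m n k := by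
    rw [Finset.card_eq_sum_card_fiberwise (f := List.length) (t := Finset.range (m + 1))]
    · refine (Finset.sum_le_card_nsmul _ _ (levelCount m n k) fun i hi => ?_).trans_eq (by simp)
      refine le_trans (Finset.card_le_card ?_)
        (levelCount_mono (Nat.lt_succ_iff.1 (Finset.mem_range.1 hi)) hmn k)
      intro u hu
      simp only [Finset.mem_filter] at hu ⊢
      exact ⟨hu.1.1, hu.2⟩
    · intro u hu
      simp only [Finset.coe_filter, Set.mem_ofPred_eq] at hu
      simpa [Nat.lt_succ_iff] using hu.2
  rw [div_le_div_iff₀ (by positivity) hm]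
  have hc' : (((finite_reducedTree n k).toFinset.filter fun u => u.length ≤ m).card : ℝ)
      ≤ ((m : ℝ) + 1) * levelCount m n k := by exact_mod_cast hc
  nlinarith [mul_le_mul_of_nonneg_right hc' hm.le]

/-! ### The branching property -/

instance (ρ : PMF ℕ) : IsProbabilityMeasure (gwLaw ρ) := by
  rw [gwLaw]
  infer_instance

/-- The family of offspring numbers with offspring number `p.1` at the root, and whose subtrees
are given by `p.2`. -/
def graft (p : ℕ × (ℕ × List ℕ → ℕ)) : List ℕ → ℕ
  | [] => p.1
  | j :: u => p.2 (j, u)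

theorem measurable_graft : Measurable graft := by
  refine measurable_pi_lambda _ fun u => ?_
  rcases u with _ | ⟨j, u⟩
  · exact measurable_fst
  · exact (measurable_pi_apply (j, u)).comp measurable_snd

theorem measurable_shift (j : ℕ) : Measurable (shift j) :=
  measurable_pi_lambda _ fun u => measurable_pi_apply (j :: u)

/-- The nonempty words are exactly the `j :: u`, so the product measure over words splits into the
root factor and a product indexed by `ℕ × List ℕ`. -/
theorem map_graft (ρ : PMF ℕ) :
    (ρ.toMeasure.prod (Measure.infinitePi fun _ : ℕ × List ℕ => ρ.toMeasure)).map graft =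
      gwLaw ρ := by
  classical
  refine Measure.eq_infinitePi _ fun s t ht => ?_
  let c : ℕ × List ℕ → List ℕ := fun p => p.1 :: p.2
  have hc : Function.Injective c := by
    rintro ⟨i, u⟩ ⟨j, v⟩ h
    simpa [c] using h
  have hpre : graft ⁻¹' (Set.pi (s : Set (List ℕ)) t) =
      (if [] ∈ s then t [] else Set.univ) ×ˢ
        Set.pi (s.preimage c hc.injOn : Set (ℕ × List ℕ)) (fun p => t (c p)) := by
    ext ⟨a, h⟩
    simp only [Set.mem_preimage, Set.mem_pi, Set.mem_prod, Finset.mem_coe, Finset.mem_preimage]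
    constructor
    · intro H
      refine ⟨?_, fun p hp => H _ hp⟩
      split_ifs with hs
      · exact H [] hs
      · trivial
    · rintro ⟨h1, h2⟩ (_ | ⟨j, u⟩) hu
      · rw [if_pos hu] at h1
        exact h1
      · exact h2 (j, u) hu
  rw [Measure.map_apply measurable_graft (.pi s.countable_toSet fun i _ => ht i), hpre,
    Measure.prod_prod, Measure.infinitePi_pi _ fun i _ => ht _,
    Finset.prod_preimage' c s hc.injOn fun u => ρ.toMeasure (t u)]
  have hrange : ∀ u, u ∈ Set.range c ↔ u ≠ [] := by
    rintro (_ | ⟨j, u⟩)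
    · simp [c]
    · simp [c]
  simp only [hrange]
  split_ifs with hs
  · rw [Finset.filter_ne', Finset.mul_prod_erase s (fun u => ρ.toMeasure (t u)) hs]
  · rw [measure_univ, one_mul, Finset.filter_true_of_mem]
    rintro u hu rfl
    exact hs hu

/-- The branching property: the root's subtrees are i.i.d. copies of the tree, independent of the
number of children. It is applied to the indicator of extinction and to `(1 - t) ^ levelCount`. -/
theorem integral_prod_shift (ρ : PMF ℕ) {H : (List ℕ → ℕ) → ℝ} (hm : Measurable H)
    (h0 : ∀ k, 0 ≤ H k) (h1 : ∀ k, H k ≤ 1) :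
    ∫ k, ∏ j ∈ Finset.Icc 1 (k []), H (shift j k) ∂gwLaw ρ =
      ∑' a, (ρ a).toReal * (∫ k, H k ∂gwLaw ρ) ^ a := by
  have hF : Measurable fun k : List ℕ → ℕ => ∏ j ∈ Finset.Icc 1 (k []), H (shift j k) := by
    have : (fun k : List ℕ → ℕ => ∏ j ∈ Finset.Icc 1 (k []), H (shift j k)) =
        (fun p : ℕ × (List ℕ → ℕ) => ∏ j ∈ Finset.Icc 1 p.1, H (shift j p.2)) ∘
          fun k => (k [], k) := rfl
    rw [this]
    refine Measurable.comp ?_ (((measurable_pi_apply []).prodMk measurable_id : _) :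
      Measurable fun k : List ℕ → ℕ => (k [], k))
    -- The number of factors is random; treating it as a separate countable variable reduces to
    -- finite products.
    refine measurable_from_prod_countable_right fun a => ?_
    change Measurable fun y => ∏ j ∈ Finset.Icc 1 a, H (shift j y)
    exact Finset.measurable_prod _ fun j _ => hm.comp (measurable_shift j)
  have hbound : ∀ k : List ℕ → ℕ, ‖∏ j ∈ Finset.Icc 1 (k []), H (shift j k)‖ ≤ 1 := by
    intro k
    rw [Real.norm_of_nonneg (Finset.prod_nonneg fun j _ => h0 _)]
    exact Finset.prod_le_one (fun j _ => h0 _) fun j _ => h1 _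
  have hind : ∀ a : ℕ, ∫ h, ∏ j ∈ Finset.Icc 1 a, H (fun u => h (j, u))
      ∂(Measure.infinitePi fun _ : ℕ × List ℕ => ρ.toMeasure) = (∫ k, H k ∂gwLaw ρ) ^ a := by
    intro a
    -- Currying turns the family indexed by `ℕ × List ℕ` into a sequence of independent trees.
    have hcurry := Measure.infinitePi_map_curry fun (_ : ℕ) (_ : List ℕ) => ρ.toMeasure
    have hm' : ∀ j : ℕ, Measurable fun h : ℕ → List ℕ → ℕ => H (h j) := fun j =>
      hm.comp (measurable_pi_apply j)
    have hmap : ∫ h, ∏ j ∈ Finset.Icc 1 a, H (fun u => h (j, u))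
        ∂(Measure.infinitePi fun _ : ℕ × List ℕ => ρ.toMeasure) =
        ∫ h, ∏ j ∈ Finset.Icc 1 a, H (h j) ∂(Measure.infinitePi fun _ : ℕ => gwLaw ρ) := by
      rw [gwLaw, ← hcurry, integral_map (MeasurableEquiv.measurable _).aemeasurable]
      · rfl
      · exact (Finset.measurable_prod _ fun j _ => hm' j).aestronglyMeasurable
    have hI : iIndepFun (fun (j : ℕ) (h : ℕ → List ℕ → ℕ) => H (h j))
        (Measure.infinitePi fun _ : ℕ => gwLaw ρ) :=
      iIndepFun_infinitePi (X := fun _ => H) fun _ => hm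
    have hI' : iIndepFun (fun (j : Finset.Icc 1 a) (h : ℕ → List ℕ → ℕ) => H (h j))
        (Measure.infinitePi fun _ : ℕ => gwLaw ρ) := hI.precomp Subtype.val_injective
    rw [hmap]
    have hj : ∀ j : ℕ, ∫ h : ℕ → List ℕ → ℕ, H (h j) ∂(Measure.infinitePi fun _ : ℕ => gwLaw ρ)
        = ∫ k, H k ∂gwLaw ρ := fun j => by
      conv_rhs => rw [← Measure.infinitePi_map_eval (fun _ : ℕ => gwLaw ρ) j]
      rw [integral_map (measurable_pi_apply j).aemeasurable hm.aestronglyMeasurable]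
    have hprod := hI'.integral_fun_prod_eq_prod_integral fun j => (hm' j).aestronglyMeasurable
    simp only [hj, Finset.prod_const, Finset.univ_eq_attach, Finset.card_attach, Nat.card_Icc,
      Nat.add_sub_cancel] at hprod
    rw [← hprod]
    refine integral_congr_ae (ae_of_all _ fun h => ?_)
    exact (Finset.prod_attach (Finset.Icc 1 a) fun j => H (h j)).symm
  have hc0 : 0 ≤ ∫ k, H k ∂gwLaw ρ := integral_nonneg h0
  have hc1 : ∫ k, H k ∂gwLaw ρ ≤ 1 := by
    refine (integral_mono_of_nonneg (ae_of_all _ h0) (integrable_const 1) (ae_of_all _ h1)).trans ?_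
    simp
  generalize (∫ k, H k ∂gwLaw ρ) = c at hind hc0 hc1
  rw [← map_graft ρ, integral_map measurable_graft.aemeasurable hF.aestronglyMeasurable,
    integral_prod]
  · have : ∀ a : ℕ, ∫ h, ∏ j ∈ Finset.Icc 1 (graft (a, h) []), H (shift j (graft (a, h)))
        ∂(Measure.infinitePi fun _ : ℕ × List ℕ => ρ.toMeasure) = c ^ a := hind
    simp_rw [this]
    rw [PMF.integral_eq_tsum]
    · simp
    · refine Integrable.of_bound (measurable_of_countable _).aestronglyMeasurable 1 ?_
      refine ae_of_all _ fun a => ?_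
      rw [Real.norm_of_nonneg (by positivity)]
      exact pow_le_one₀ hc0 hc1
  · refine Integrable.of_bound (hF.comp measurable_graft).aestronglyMeasurable 1 ?_
    exact ae_of_all _ fun p => hbound _

/-! ### Measurability -/

theorem measurableSet_mem_planeTree (u : List ℕ) : MeasurableSet {k | u ∈ planeTree k} := by
  have : {k | u ∈ planeTree k} =
      ⋂ (v : List ℕ) (j : ℕ) (_ : v ++ [j] <+: u), {k : List ℕ → ℕ | 1 ≤ j ∧ j ≤ k v} := by
    ext k
    simp [planeTree]
  rw [this]
  refine .iInter fun v => .iInter fun j => .iInter fun _ => ?_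
  have hv : Measurable fun k : List ℕ → ℕ => k v := measurable_pi_apply v
  exact hv (MeasurableSet.of_discrete (s := {i : ℕ | 1 ≤ j ∧ j ≤ i}))

theorem measurableSet_mem_reducedTree (n : ℕ) (u : List ℕ) :
    MeasurableSet {k | u ∈ reducedTree n k} := by
  have : {k | u ∈ reducedTree n k} = {k | u ∈ planeTree k} ∩
      ⋃ (w : List ℕ) (_ : w.length = n ∧ u <+: w), {k | w ∈ planeTree k} := by
    ext k
    simp only [reducedTree, Set.mem_inter_iff, Set.mem_iUnion, Set.mem_ofPred_eq]
    constructor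
    · rintro ⟨hu, w, hw, h⟩
      exact ⟨hu, w, h, hw⟩
    · rintro ⟨hu, w, h, hw⟩
      exact ⟨hu, w, hw, h⟩
  rw [this]
  exact (measurableSet_mem_planeTree u).inter
    (.iUnion fun w => .iUnion fun _ => measurableSet_mem_planeTree w)

theorem measurableSet_survives (n : ℕ) : MeasurableSet (survives n) := by
  have : survives n = ⋃ (u : List ℕ) (_ : u.length = n), {k | u ∈ planeTree k} := by
    ext k
    simp only [survives, Set.mem_iUnion, Set.mem_ofPred_eq]
    exact ⟨fun ⟨u, hu, h⟩ => ⟨u, h, hu⟩, fun ⟨u, h, hu⟩ => ⟨u, hu, h⟩⟩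
  rw [this]
  exact .iUnion fun u => .iUnion fun _ => measurableSet_mem_planeTree u

/-- Every function of the reduced tree is measurable. -/
theorem measurable_comp_toFinset_reducedTree {β : Type*} [MeasurableSpace β] (n : ℕ)
    (g : Finset (List ℕ) → β) : Measurable fun k => g (finite_reducedTree n k).toFinset := by
  intro B _
  have : (fun k => g (finite_reducedTree n k).toFinset) ⁻¹' B =
      ⋃ (S : Finset (List ℕ)) (_ : g S ∈ B), ⋂ u : List ℕ, {k | u ∈ reducedTree n k ↔ u ∈ S} := by
    ext k
    simp only [Set.mem_preimage, Set.mem_iUnion, Set.mem_iInter, Set.mem_ofPred_eq]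
    constructor
    · intro h
      exact ⟨_, h, fun u => ((finite_reducedTree n k).mem_toFinset).symm⟩
    · rintro ⟨S, hS, h⟩
      have : (finite_reducedTree n k).toFinset = S := by
        ext u
        rw [Set.Finite.mem_toFinset, h]
      rwa [this]
  rw [this]
  refine .iUnion fun S => .iUnion fun _ => .iInter fun u => ?_
  by_cases hu : u ∈ S
  · simpa only [hu, iff_true] using measurableSet_mem_reducedTree n u
  · simp only [hu, iff_false]
    exact (measurableSet_mem_reducedTree n u).compl

theorem measurable_levelCount (m n : ℕ) : Measurable (levelCount m n) :=
  measurable_comp_toFinset_reducedTree n fun S => (S.filter fun u : List ℕ => u.length = m).card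

theorem measurable_conductance (n : ℕ) :
    Measurable fun k => conductance n (reducedTree n k) := by
  have := measurable_comp_toFinset_reducedTree n fun S => conductance n (S : Set (List ℕ))
  simpa only [Set.Finite.coe_toFinset] using this

/-! ### Generating functions -/

/-- The generating function of `ρ`. -/
noncomputable def genFun (ρ : PMF ℕ) (s : ℝ) : ℝ := ∑' a, (ρ a).toReal * s ^ a

/-- The map `u ↦ 1 - f (1 - u)`, where `f` is the generating function of `ρ`. -/
noncomputable def coGenFun (ρ : PMF ℕ) (u : ℝ) : ℝ := 1 - genFun ρ (1 - u)

/-- Extinction at generation `n + 1` means that the subtrees of all children of the root are extinct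
at generation `n`. -/
theorem measure_survives (ρ : PMF ℕ) (n : ℕ) :
    (gwLaw ρ).real (survives n) = (coGenFun ρ)^[n] 1 := by
  classical
  induction n with
  | zero => simp [survives_zero]
  | succ n ih =>
    have hc : (gwLaw ρ).real (survives n)ᶜ = 1 - (coGenFun ρ)^[n] 1 := by
      rw [probReal_compl_eq_one_sub (measurableSet_survives n), ih]
    have h := integral_prod_shift ρ (H := (survives n)ᶜ.indicator 1)
      (measurable_one.indicator (measurableSet_survives n).compl)
      (fun k => Set.indicator_nonneg (fun _ _ => zero_le_one) k)
      (fun k => Set.indicator_le_self' (fun _ _ => zero_le_one) k)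
    rw [integral_indicator_one (measurableSet_survives n).compl, hc] at h
    have hp : ∀ k : List ℕ → ℕ, ∏ j ∈ Finset.Icc 1 (k []),
        (survives n)ᶜ.indicator (1 : (List ℕ → ℕ) → ℝ) (shift j k) =
          (survives (n + 1))ᶜ.indicator 1 k := by
      intro k
      by_cases hk : k ∈ survives (n + 1)
      · rw [Set.indicator_of_notMem (by simpa using hk)]
        obtain ⟨j, hj, hj'⟩ := mem_survives_succ.1 hk
        exact Finset.prod_eq_zero hj (Set.indicator_of_notMem (by simpa using hj') _)
      · rw [Set.indicator_of_mem (by simpa using hk), Pi.one_apply]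
        refine Finset.prod_eq_one fun j hj => Set.indicator_of_mem ?_ _
        exact fun hj' => hk (mem_survives_succ.2 ⟨j, hj, hj'⟩)
    simp_rw [hp] at h
    rw [integral_indicator_one (measurableSet_survives (n + 1)).compl,
      probReal_compl_eq_one_sub (measurableSet_survives (n + 1))] at h
    rw [Function.iterate_succ_apply', coGenFun, genFun, ← h]
    ring

/-- Induction on `m` with `l` fixed: counts add over the children of the root, so `(1 - t) ^
levelCount` is multiplicative. At `m = 0` the count is the indicator of survival up to `l`. -/
theorem integral_pow_levelCount (ρ : PMF ℕ) {t : ℝ} (h0 : 0 ≤ t) (h1 : t ≤ 1) (m l : ℕ) :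
    ∫ k, (1 - t) ^ levelCount m (m + l) k ∂gwLaw ρ =
      1 - (coGenFun ρ)^[m] (t * (coGenFun ρ)^[l] 1) := by
  classical
  induction m with
  | zero =>
    have : ∀ k, (1 - t) ^ levelCount 0 (0 + l) k = 1 - t * (survives l).indicator 1 k := by
      intro k
      rw [levelCount_zero, zero_add]
      by_cases hk : k ∈ survives l <;> simp [hk]
    simp_rw [this]
    rw [integral_sub (integrable_const _), integral_const_mul,
      integral_indicator_one (measurableSet_survives l), measure_survives]
    · simp
    · exact ((integrable_const (1 : ℝ)).indicator (measurableSet_survives l)).const_mul t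
  | succ m ih =>
    have h := integral_prod_shift ρ (H := fun k => (1 - t) ^ levelCount m (m + l) k)
      (measurable_const.pow (measurable_levelCount m (m + l)))
      (fun k => pow_nonneg (by linarith) _) (fun k => pow_le_one₀ (by linarith) (by linarith))
    simp_rw [Finset.prod_pow_eq_pow_sum, ← levelCount_succ] at h
    rw [show m + 1 + l = m + l + 1 by omega, h, ih, Function.iterate_succ_apply', coGenFun, genFun]
    ring

/-! ### Iteration of `v ↦ v - G v` -/

/-- A convex function `G` on `[0, 1]` such that `v ↦ v - G v` is the conjugate of the generating
function of a critical offspring distribution. -/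
structure IsCriticalGap (G : ℝ → ℝ) : Prop where
  convexOn : ConvexOn ℝ (Set.Icc 0 1) G
  zero : G 0 = 0
  nonneg : ∀ v, 0 ≤ v → v ≤ 1 → 0 ≤ G v
  one_lt : G 1 < 1

namespace IsCriticalGap

variable {G : ℝ → ℝ}

theorem mul_le (h : IsCriticalGap G) {c v : ℝ}
    (hc0 : 0 ≤ c) (hc1 : c ≤ 1) (hv0 : 0 ≤ v) (hv1 : v ≤ 1) :
    G (c * v) ≤ c * G v := by
  have := h.convexOn.2 (x := v) ⟨hv0, hv1⟩ (y := 0) ⟨le_rfl, zero_le_one⟩ hc0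
    (sub_nonneg.2 hc1) (by ring)
  simpa [h.zero] using this

/-- Since `G` is convex with `G 0 = 0`, the slope `G v / v` is nondecreasing; denominators are
cleared to allow `0`. -/
theorem mul_le_mul_of_le (h : IsCriticalGap G) {w v : ℝ} (hw0 : 0 ≤ w) (hwv : w ≤ v) (hv1 : v ≤ 1) :
    G w * v ≤ w * G v := by
  rcases hw0.eq_or_lt with rfl | hw
  · simp [h.zero]
  have hv := hw.trans_le hwv
  have := h.mul_le (div_nonneg hw0 hv.le) ((div_le_one hv).2 hwv) hv.le hv1
  rw [div_mul_cancel₀ _ hv.ne'] at this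
  calc G w * v ≤ (w / v * G v) * v := by gcongr
    _ = w * G v := by field_simp

theorem mono (h : IsCriticalGap G) {w v : ℝ} (hw0 : 0 ≤ w) (hwv : w ≤ v) (hv1 : v ≤ 1) :
    G w ≤ G v := by
  rcases hw0.eq_or_lt with rfl | hw
  · rw [h.zero]
    exact h.nonneg v hwv hv1
  have hv := hw.trans_le hwv
  refine le_of_mul_le_mul_right ((h.mul_le_mul_of_le hw0 hwv hv1).trans ?_) hv
  rw [mul_comm]
  exact mul_le_mul_of_nonneg_left hwv (h.nonneg v hv.le hv1)

theorem le_mul_one (h : IsCriticalGap G) {v : ℝ} (hv0 : 0 ≤ v) (hv1 : v ≤ 1) : G v ≤ v * G 1 := by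
  simpa using h.mul_le_mul_of_le hv0 hv1 le_rfl

theorem iterate_mem (h : IsCriticalGap G) {u : ℝ} (hu0 : 0 ≤ u) (hu1 : u ≤ 1) (m : ℕ) :
    0 ≤ (fun v => v - G v)^[m] u ∧ (fun v => v - G v)^[m] u ≤ u := by
  induction m with
  | zero => exact ⟨hu0, le_rfl⟩
  | succ m ih =>
    rw [Function.iterate_succ_apply']
    have h1 := h.le_mul_one ih.1 (ih.2.trans hu1)
    have h2 := h.nonneg _ ih.1 (ih.2.trans hu1)
    have h3 := h.one_lt
    constructor
    · nlinarith [ih.1]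
    · linarith [ih.2]

theorem sub_iterate_le (h : IsCriticalGap G) {u : ℝ} (hu0 : 0 ≤ u) (hu1 : u ≤ 1) (m : ℕ) :
    u - (fun v => v - G v)^[m] u ≤ m * G u := by
  induction m with
  | zero => simp
  | succ m ih =>
    rw [Function.iterate_succ_apply']
    have hm := h.iterate_mem hu0 hu1 m
    have := h.mono hm.1 hm.2 hu1
    push_cast
    linarith

/-- The left side is the mean of a second difference of powers. The orbit of `u / 2` stays below `u
/ 2`, and that of `u` loses at most `G u` per step. -/
theorem two_mul_iterate_half_sub_le (h : IsCriticalGap G) {u : ℝ} (hu0 : 0 ≤ u) (hu1 : u ≤ 1)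
    (m : ℕ) :
    2 * (fun v => v - G v)^[m] (u / 2) - (fun v => v - G v)^[m] u ≤ m * G u := by
  have h1 := h.sub_iterate_le hu0 hu1 m
  have h2 := (h.iterate_mem (u := u / 2) (by linarith) (by linarith) m).2
  linarith

theorem iterate_one_pos (h : IsCriticalGap G) (n : ℕ) : 0 < (fun v => v - G v)^[n] 1 := by
  induction n with
  | zero => exact zero_lt_one
  | succ n ih =>
    rw [Function.iterate_succ_apply']
    have h1 := h.le_mul_one ih.le (h.iterate_mem zero_le_one le_rfl n).2
    nlinarith [h.one_lt]

/-- A one-sided Potter bound. Regular variation is used at a single ratio `c`, where it beats the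
tangent line `1 - r (1 - c)` of the power `r`; convexity interpolates this line on `[c, 1]`, where
Bernoulli puts it below `μ ^ r`. Composing such steps reaches every `μ ≥ c ^ n`. -/
theorem exists_forall_le_rpow (h : IsCriticalGap G) {α r : ℝ} (hr : 1 < r) (hrα : r < α)
    (hpos : ∀ᶠ x in 𝓝[>] (0 : ℝ), 0 < G x)
    (hreg : ∀ c : ℝ, 0 < c → c < 1 →
      Tendsto (fun x => G (c * x) / G x) (𝓝[>] 0) (𝓝 (c ^ α))) :
    ∃ δ : ℝ, 0 < δ ∧ δ ≤ 1 ∧ 0 < G δ ∧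
      ∀ v, 0 < v → v ≤ δ → ∀ c, 0 ≤ c → c ≤ 1 → G (c * v) ≤ c ^ r * G v := by
  have hr0 : 0 < r := by linarith
  have hα0 : 0 < α := by linarith
  obtain ⟨c, hc0, hc1, hc⟩ : ∃ c : ℝ, 0 < c ∧ c < 1 ∧ c ^ α < 1 - r * (1 - c) := by
    -- With `c = 1 - t` it suffices that `1 < (1 - r t) (1 + α t)`, that is `t < (α - r) / (r α)`;
    -- half this bound is taken.
    obtain ⟨t, ht⟩ : ∃ t, t = (α - r) / (2 * r * α) := ⟨_, rfl⟩
    have ht0 : 0 < t := ht ▸ div_pos (by linarith) (by positivity)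
    have hte : t * (2 * r * α) = α - r := by rw [ht]; field_simp
    have ht1 : t < 1 := by
      rw [ht, div_lt_one (by positivity)]
      nlinarith
    refine ⟨1 - t, by linarith, by linarith, ?_⟩
    have h1 : (1 - t) ^ α ≤ Real.exp (-(α * t)) := by
      have := Real.rpow_le_rpow (by linarith) (Real.one_sub_le_exp_neg t) hα0.le
      rwa [← Real.exp_mul, show -t * α = -(α * t) by ring] at this
    have h2 : Real.exp (-(α * t)) ≤ 1 / (1 + α * t) := by
      rw [Real.exp_neg, ← one_div]
      exact one_div_le_one_div_of_le (by positivity) (by linarith [Real.add_one_le_exp (α * t)])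
    refine (h1.trans h2).trans_lt ?_
    rw [div_lt_iff₀ (by positivity)]
    nlinarith [mul_pos ht0 (sub_pos.2 hrα)]
  obtain ⟨ε, hε, hεc⟩ := (mem_nhdsGT_iff_exists_Ioo_subset).1
    (((hreg c hc0 hc1).eventually_lt_const hc).and hpos)
  have hε' : (0 : ℝ) < ε := hε
  refine ⟨min (ε / 2) 1, by positivity, min_le_right _ _, (hεc ⟨by positivity, ?_⟩).2, ?_⟩
  · exact (min_le_left _ _).trans_lt (by linarith)
  have base : ∀ v, 0 < v → v ≤ min (ε / 2) 1 → ∀ μ, c ≤ μ → μ ≤ 1 → G (μ * v) ≤ μ ^ r * G v := by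
    intro v hv0 hv μ hcμ hμ1
    have hv1 : v ≤ 1 := hv.trans (min_le_right _ _)
    obtain ⟨hlt, hGv⟩ := hεc (a := v) ⟨hv0, (hv.trans (min_le_left _ _)).trans_lt (by linarith)⟩
    have hlt' : G (c * v) < (1 - r * (1 - c)) * G v := (div_lt_iff₀ hGv).1 hlt
    have h1c : 0 < 1 - c := by linarith
    obtain ⟨θ, hθ⟩ : ∃ θ, θ = (1 - μ) / (1 - c) := ⟨_, rfl⟩
    have hθ0 : 0 ≤ θ := hθ ▸ div_nonneg (by linarith) h1c.le
    have hθ1 : θ ≤ 1 := hθ ▸ (div_le_one h1c).2 (by linarith)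
    have hθe : θ * (1 - c) = 1 - μ := by rw [hθ]; field_simp
    have hconv := h.convexOn.2 (x := v) ⟨hv0.le, hv1⟩ (y := c * v)
      ⟨by positivity, by nlinarith⟩ (sub_nonneg.2 hθ1) hθ0 (by ring)
    simp only [smul_eq_mul] at hconv
    rw [show (1 - θ) * v + θ * (c * v) = μ * v by linear_combination (-v) * hθe] at hconv
    have hB : 1 - r * (1 - μ) ≤ μ ^ r := by
      have := one_add_mul_self_le_rpow_one_add (s := μ - 1) (by linarith) hr.le
      rw [show 1 + (μ - 1) = μ by ring] at this
      linarith
    calc G (μ * v) ≤ (1 - θ) * G v + θ * G (c * v) := hconv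
      _ ≤ (1 - θ) * G v + θ * ((1 - r * (1 - c)) * G v) := by gcongr
      _ = (1 - r * (1 - μ)) * G v := by linear_combination (-r * G v) * hθe
      _ ≤ μ ^ r * G v := by gcongr
  have step : ∀ n : ℕ, ∀ v, 0 < v → v ≤ min (ε / 2) 1 → ∀ μ, c ^ n ≤ μ → μ ≤ 1 →
      G (μ * v) ≤ μ ^ r * G v := by
    intro n
    induction n with
    | zero =>
      intro v hv0 hv μ hcμ hμ1
      exact base v hv0 hv μ (by rw [pow_zero] at hcμ; linarith) hμ1
    | succ n ih =>
      intro v hv0 hv μ hcμ hμ1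
      rcases le_total c μ with hle | hle
      · exact base v hv0 hv μ hle hμ1
      have hμ0 : 0 < μ := (pow_pos hc0 _).trans_le hcμ
      have hμc : μ / c ≤ 1 := (div_le_one hc0).2 hle
      have hμc0 : 0 < μ / c := div_pos hμ0 hc0
      have h1 := base (μ / c * v) (by positivity) (by nlinarith) c le_rfl hc1.le
      have h2 := ih v hv0 hv (μ / c) ((le_div_iff₀ hc0).2 (by rwa [← pow_succ])) hμc
      rw [show c * (μ / c * v) = μ * v by field_simp] at h1
      calc G (μ * v) ≤ c ^ r * G (μ / c * v) := h1
        _ ≤ c ^ r * ((μ / c) ^ r * G v) := by gcongr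
        _ = μ ^ r * G v := by
          rw [← mul_assoc, ← Real.mul_rpow hc0.le hμc0.le, mul_div_cancel₀ _ hc0.ne']
  intro v hv0 hv μ hμ0 hμ1
  rcases hμ0.eq_or_lt with rfl | hμ
  · rw [zero_mul, h.zero, Real.zero_rpow hr0.ne', zero_mul]
  · obtain ⟨n, hn⟩ := exists_pow_lt_of_lt_one hμ hc1
    exact step n v hv0 hv μ hn.le hμ1

/-- Extends the scaling from `v ≤ δ` to `v ≤ 1`. If `c v ≤ δ ≤ v`, compare through `δ`; if `c v ≥
δ`, then `c ≥ δ` and the constant absorbs `c ^ r`. -/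
theorem le_mul_rpow (h : IsCriticalGap G) {δ r : ℝ} (hr1 : 1 < r) (hδ0 : 0 < δ) (hδ1 : δ ≤ 1)
    (hscale : ∀ v, 0 < v → v ≤ δ → ∀ c, 0 ≤ c → c ≤ 1 → G (c * v) ≤ c ^ r * G v)
    {c v : ℝ} (hc0 : 0 ≤ c) (hc1 : c ≤ 1) (hv0 : 0 ≤ v) (hv1 : v ≤ 1) :
    G (c * v) ≤ (1 / δ) ^ r * c ^ r * G v := by
  have hr0 : 0 ≤ r := by linarith
  have hGv := h.nonneg v hv0 hv1
  have hone : 1 ≤ (1 / δ) ^ r := Real.one_le_rpow (by rw [one_le_div hδ0]; exact hδ1) hr0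
  rcases hv0.eq_or_lt with rfl | hv
  · simp [h.zero]
  rcases le_total v δ with hle | hle
  · calc G (c * v) ≤ c ^ r * G v := hscale v hv hle c hc0 hc1
      _ = 1 * c ^ r * G v := by ring
      _ ≤ (1 / δ) ^ r * c ^ r * G v := by gcongr
  rcases le_total (c * v) δ with hcv | hcv
  · have h1 := hscale δ hδ0 le_rfl (c * v / δ) (by positivity) ((div_le_one hδ0).2 hcv)
    rw [div_mul_cancel₀ _ hδ0.ne'] at h1
    calc G (c * v) ≤ (c * v / δ) ^ r * G δ := h1
      _ ≤ (c / δ) ^ r * G v := by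
        gcongr
        · exact h.nonneg δ hδ0.le hδ1
        · nlinarith
        · exact h.mono hδ0.le hle hv1
      _ = (1 / δ) ^ r * c ^ r * G v := by
        rw [← Real.mul_rpow (by positivity) hc0]
        congr 2
        ring
  · have hδc : δ ≤ c := by nlinarith
    calc G (c * v) ≤ G v := h.mono (by positivity) (by nlinarith) hv1
      _ = 1 * G v := by ring
      _ ≤ (1 / δ * c) ^ r * G v := by
        gcongr
        exact Real.one_le_rpow (by rw [div_mul_eq_mul_div, one_mul, one_le_div hδ0]; exact hδc) hr0
      _ = (1 / δ) ^ r * c ^ r * G v := by rw [Real.mul_rpow (by positivity) hc0]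

/-- Scaling from `x` to `x - G x` shows that `y = (r - 1) G x / x` becomes at most `y (1 - y)` after
one step, a discrete `y' = -y ^ 2`; hence `i y ≤ 1` after `i` steps below `δ`. -/
theorem exists_nat_mul_le (h : IsCriticalGap G) {δ r : ℝ} (hr1 : 1 < r) (hδ0 : 0 < δ)
    (hGδ : 0 < G δ)
    (hscale : ∀ v, 0 < v → v ≤ δ → ∀ c, 0 ≤ c → c ≤ 1 → G (c * v) ≤ c ^ r * G v)
    (hr2 : r ≤ 2) :
    ∃ C : ℝ, 0 ≤ C ∧ ∀ n : ℕ,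
      n * G ((fun v => v - G v)^[n] 1) ≤ C * (fun v => v - G v)^[n] 1 := by
  have hq0 := h.iterate_one_pos
  have hq1 := fun n => (h.iterate_mem zero_le_one le_rfl n).2
  have hGq := fun n => h.nonneg _ (hq0 n).le (hq1 n)
  have hqs : ∀ n, (fun v => v - G v)^[n + 1] 1 =
      (fun v => v - G v)^[n] 1 - G ((fun v => v - G v)^[n] 1) := fun n =>
    Function.iterate_succ_apply' _ _ _
  generalize hq : (fun n => (fun v => v - G v)^[n] (1 : ℝ)) = q at *
  have hqn : ∀ n, (fun v => v - G v)^[n] (1 : ℝ) = q n := fun n => congrFun hq n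
  simp only [hqn] at *
  have hanti : ∀ n, q (n + 1) ≤ q n := fun n => by linarith [hqs n, hGq n]
  -- While the orbit stays above `δ`, each step removes at least `G δ > 0`.
  obtain ⟨n₀, hn₀⟩ : ∃ n, q n ≤ δ := by
    by_contra! hcon
    have : ∀ n : ℕ, q n ≤ 1 - n * G δ := by
      intro n
      induction n with
      | zero => simpa using hq1 0
      | succ n ih =>
        have := h.mono hδ0.le (hcon n).le (hq1 n)
        rw [hqs]
        push_cast
        linarith
    obtain ⟨n, hn⟩ := exists_nat_gt (1 / G δ)
    rw [div_lt_iff₀ hGδ] at hn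
    linarith [this n, hq0 n]
  have hle : ∀ i, q (n₀ + i) ≤ δ := by
    intro i
    induction i with
    | zero => exact hn₀
    | succ i ih => exact (hanti _).trans ih
  have hp : 0 < r - 1 := by linarith
  have key : ∀ i : ℕ, i * ((r - 1) * G (q (n₀ + i))) ≤ q (n₀ + i) := by
    intro i
    induction i with
    | zero => simpa using (hq0 n₀).le
    | succ i ih =>
      rw [← add_assoc, hqs]
      obtain ⟨x, hx⟩ : ∃ x, x = q (n₀ + i) := ⟨_, rfl⟩
      have hx0 : 0 < x := hx ▸ hq0 _
      have hx1 : x ≤ 1 := hx ▸ hq1 _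
      have hxδ : x ≤ δ := hx ▸ hle _
      rw [← hx] at ih ⊢
      obtain ⟨b, hb⟩ : ∃ b, b = G x / x := ⟨_, rfl⟩
      have hGx : G x = b * x := by rw [hb]; field_simp
      have hb0 : 0 ≤ b := hb ▸ div_nonneg (h.nonneg x hx0.le hx1) hx0.le
      have hb1 : b ≤ 1 := by
        rw [hb, div_le_one hx0]
        nlinarith [h.le_mul_one hx0.le hx1, h.one_lt]
      have hy : i * ((r - 1) * b) ≤ 1 := by
        refine le_of_mul_le_mul_right ?_ hx0
        rw [hGx] at ih
        linarith
      have h1 := hscale x hx0 hxδ (1 - b) (by linarith) (by linarith)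
      rw [hGx, show x - b * x = (1 - b) * x by ring]
      rw [hGx] at h1
      -- Bernoulli's inequality for the exponent `r - 1 ≤ 1`, in its concave direction.
      have h2 : (1 - b) ^ r ≤ (1 - b) * (1 - (r - 1) * b) := by
        rcases hb1.eq_or_lt with rfl | hb1
        · rw [sub_self, Real.zero_rpow (by linarith), zero_mul]
        have h3 := rpow_one_add_le_one_add_mul_self (s := -b) (by linarith) hp.le
          (by linarith)
        have h4 : (1 - b) ^ r = (1 - b) * (1 - b) ^ (r - 1) := by
          rw [← Real.rpow_one_add' (by linarith) (by linarith)]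
          congr 1
          ring
        rw [h4]
        refine mul_le_mul_of_nonneg_left ?_ (by linarith)
        rw [← sub_eq_add_neg] at h3
        linarith
      have h5 : (i + 1) * ((r - 1) * b * (1 - (r - 1) * b)) ≤ 1 := by
        have hy0 : 0 ≤ (r - 1) * b := by positivity
        have hy1 : (r - 1) * b ≤ 1 := by nlinarith
        nlinarith [mul_le_mul_of_nonneg_right hy (sub_nonneg.2 hy1), mul_nonneg hy0 hy0]
      push_cast
      calc ((i : ℝ) + 1) * ((r - 1) * G ((1 - b) * x))
          ≤ ((i : ℝ) + 1) * ((r - 1) * ((1 - b) * (1 - (r - 1) * b) * (b * x))) := by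
            gcongr
            exact h1.trans (by gcongr)
        _ = ((i + 1) * ((r - 1) * b * (1 - (r - 1) * b))) * ((1 - b) * x) := by ring
        _ ≤ 1 * ((1 - b) * x) := by
            refine mul_le_mul_of_nonneg_right h5 (mul_nonneg (by linarith) hx0.le)
        _ = (1 - b) * x := one_mul _
  -- For `n ≤ 2 n₀` use `G q ≤ q`; beyond, `n ≤ 2 (n - n₀)` and `key` applies.
  refine ⟨2 * n₀ + 2 / (r - 1), by positivity, fun n => ?_⟩
  have hGn : G (q n) ≤ q n := by nlinarith [h.le_mul_one (hq0 n).le (hq1 n), h.one_lt, hq0 n]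
  have hpq : 0 ≤ 2 / (r - 1) * q n := mul_nonneg (by positivity) (hq0 n).le
  rw [add_mul]
  rcases le_total n (2 * n₀) with hn | hn
  · have hn' : (n : ℝ) ≤ 2 * n₀ := by exact_mod_cast hn
    have := mul_le_mul hn' hGn (hGq n) (by positivity)
    linarith
  · obtain ⟨i, rfl⟩ := Nat.exists_eq_add_of_le (show n₀ ≤ n by omega)
    have hi : ((n₀ + i : ℕ) : ℝ) ≤ 2 * i := by
      exact_mod_cast (by omega : n₀ + i ≤ 2 * i)
    have h1 : (i : ℝ) * G (q (n₀ + i)) ≤ q (n₀ + i) / (r - 1) := by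
      rw [le_div_iff₀ hp]
      linarith [key i]
    have h2 := mul_le_mul_of_nonneg_right hi (hGq (n₀ + i))
    have h3 : 2 / (r - 1) * q (n₀ + i) = 2 * (q (n₀ + i) / (r - 1)) := by ring
    have h4 : 0 ≤ 2 * (n₀ : ℝ) * q (n₀ + i) := mul_nonneg (by positivity) (hq0 _).le
    linarith

/-- By monotone slopes each step multiplies by at least `1 - b`, `b = G u / u`. As `b ≤ G 1 < 1`,
this factor is at least `exp (-b / (1 - G 1))`. -/
theorem mul_exp_le_iterate (h : IsCriticalGap G) {u : ℝ} (hu0 : 0 < u) (hu1 : u ≤ 1) (j : ℕ) :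
    u * Real.exp (-(j * (G u / u) / (1 - G 1))) ≤ (fun v => v - G v)^[j] u := by
  have hκ : 0 < 1 - G 1 := by linarith [h.one_lt]
  obtain ⟨b, hb⟩ : ∃ b, b = G u / u := ⟨_, rfl⟩
  have hGu : G u = b * u := by rw [hb]; field_simp
  have hb0 : 0 ≤ b := hb ▸ div_nonneg (h.nonneg u hu0.le hu1) hu0.le
  have hb1 : b ≤ G 1 := by
    rw [hb, div_le_iff₀ hu0, mul_comm]
    exact h.le_mul_one hu0.le hu1
  have hexp : Real.exp (-(b / (1 - G 1))) ≤ 1 - b := by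
    have h1 : 0 < 1 + b / (1 - G 1) := by positivity
    rw [Real.exp_neg]
    refine (inv_anti₀ h1 (by linarith [Real.add_one_le_exp (b / (1 - G 1))])).trans ?_
    rw [inv_le_iff_one_le_mul₀' h1]
    have h2 : (1 + b / (1 - G 1)) * (1 - b) = 1 + b / (1 - G 1) * (G 1 - b) := by
      field_simp
      ring
    rw [h2]
    have : 0 ≤ b / (1 - G 1) * (G 1 - b) := mul_nonneg (by positivity) (by linarith)
    linarith
  rw [← hb]
  induction j with
  | zero => simp
  | succ j ih =>
    rw [Function.iterate_succ_apply']
    obtain ⟨hv0, hvu⟩ := h.iterate_mem hu0.le hu1 j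
    generalize (fun v => v - G v)^[j] u = v at *
    have h1 : G v ≤ b * v := by
      refine le_of_mul_le_mul_right ((h.mul_le_mul_of_le hv0 hvu hu1).trans_eq ?_) hu0
      rw [hGu]
      ring
    have h2 : -(((j + 1 : ℕ) : ℝ) * b / (1 - G 1)) =
        -(j * b / (1 - G 1)) + -(b / (1 - G 1)) := by
      push_cast
      ring
    rw [h2, Real.exp_add, ← mul_assoc]
    calc u * Real.exp (-(j * b / (1 - G 1))) * Real.exp (-(b / (1 - G 1)))
        ≤ v * (1 - b) := by gcongr
      _ ≤ v - G v := by linarith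

/-- For `m ≤ l`, the previous bounds make the total exponent over `m` more steps at most `C / (1 - G
1)`, so `q_{m+l}` is comparable to `q_l`. -/
theorem exists_nat_mul_le_iterate_add (h : IsCriticalGap G) {δ r : ℝ} (hr1 : 1 < r)
    (hδ0 : 0 < δ) (hGδ : 0 < G δ)
    (hscale : ∀ v, 0 < v → v ≤ δ → ∀ c, 0 ≤ c → c ≤ 1 → G (c * v) ≤ c ^ r * G v)
    (hr2 : r ≤ 2) :
    ∃ D : ℝ, 0 ≤ D ∧ ∀ m l : ℕ, m ≤ l →
      m * G ((fun v => v - G v)^[l] 1) ≤ D * (fun v => v - G v)^[m + l] 1 := by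
  obtain ⟨C, hC0, hC⟩ := h.exists_nat_mul_le hr1 hδ0 hGδ hscale hr2
  have hκ : 0 < 1 - G 1 := by linarith [h.one_lt]
  refine ⟨C * Real.exp (C / (1 - G 1)), by positivity, fun m l hml => ?_⟩
  have hu0 := h.iterate_one_pos l
  have hu1 := (h.iterate_mem zero_le_one le_rfl l).2
  have hl := hC l
  rw [Function.iterate_add_apply]
  generalize (fun v => v - G v)^[l] (1 : ℝ) = u at *
  have hm : m * G u ≤ C * u :=
    (mul_le_mul_of_nonneg_right (Nat.cast_le.2 hml) (h.nonneg u hu0.le hu1)).trans hl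
  have hexp : Real.exp (-(C / (1 - G 1))) ≤ Real.exp (-(m * (G u / u) / (1 - G 1))) := by
    refine Real.exp_le_exp.2 (neg_le_neg ?_)
    gcongr
    rw [← mul_div_assoc, div_le_iff₀ hu0]
    exact hm
  have h1 := (mul_le_mul_of_nonneg_left hexp hu0.le).trans (h.mul_exp_le_iterate hu0 hu1 m)
  calc m * G u ≤ C * u := hm
    _ = C * Real.exp (C / (1 - G 1)) * (u * Real.exp (-(C / (1 - G 1)))) := by
      rw [Real.exp_neg]
      field_simp
    _ ≤ _ := mul_le_mul_of_nonneg_left h1 (by positivity)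

end IsCriticalGap

/-! ### The generating function of a critical offspring distribution -/

/-- The difference between `1 - v` and the value at `1 - v` of the generating function of `ρ`. -/
noncomputable def gap (ρ : PMF ℕ) (v : ℝ) : ℝ := genFun ρ (1 - v) - (1 - v)

theorem coGenFun_eq (ρ : PMF ℕ) : coGenFun ρ = fun v => v - gap ρ v := by
  funext v
  rw [coGenFun, gap]
  ring

theorem hasSum_toReal (ρ : PMF ℕ) : HasSum (fun a => (ρ a).toReal) 1 := by
  have h := ENNReal.tsum_toReal_eq fun a => ρ.apply_ne_top a
  rw [ρ.tsum_coe, ENNReal.toReal_one] at h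
  rw [h]
  exact (ENNReal.summable_toReal (by rw [ρ.tsum_coe]; exact ENNReal.one_ne_top)).hasSum

theorem hasSum_genFun (ρ : PMF ℕ) {s : ℝ} (h0 : 0 ≤ s) (h1 : s ≤ 1) :
    HasSum (fun a => (ρ a).toReal * s ^ a) (genFun ρ s) := by
  refine Summable.hasSum (Summable.of_nonneg_of_le (fun a => by positivity) (fun a => ?_)
    (hasSum_toReal ρ).summable)
  exact mul_le_of_le_one_right ENNReal.toReal_nonneg (pow_le_one₀ h0 h1)

theorem hasSum_mean {ρ : PMF ℕ} (hmean : ∑' k : ℕ, (k : ENNReal) * ρ k = 1) :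
    HasSum (fun a : ℕ => (a : ℝ) * (ρ a).toReal) 1 := by
  have h := ENNReal.tsum_toReal_eq (f := fun a : ℕ => (a : ENNReal) * ρ a) fun a =>
    ENNReal.mul_ne_top (ENNReal.natCast_ne_top a) (ρ.apply_ne_top a)
  have hs := ENNReal.summable_toReal (f := fun a : ℕ => (a : ENNReal) * ρ a)
    (by rw [hmean]; exact ENNReal.one_ne_top)
  rw [hmean, ENNReal.toReal_one] at h
  simp only [ENNReal.toReal_mul, ENNReal.toReal_natCast] at h hs
  rw [h]
  exact hs.hasSum

/-- Convexity is termwise. Nonnegativity is Bernoulli's `(1 - v) ^ k ≥ 1 - k v` summed with mean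
one. Finally `G 1 = ρ 0`, which is not `1` because the mean is not `0`. -/
theorem isCriticalGap_gap {ρ : PMF ℕ} (hmean : ∑' k : ℕ, (k : ENNReal) * ρ k = 1) :
    IsCriticalGap (gap ρ) where
  convexOn := by
    refine ⟨convex_Icc 0 1, ?_⟩
    intro x hx y hy a b ha hb hab
    have hz : a * x + b * y ∈ Set.Icc (0 : ℝ) 1 := by
      simpa using (convex_Icc (0 : ℝ) 1) hx hy ha hb hab
    have h1 := hasSum_genFun ρ (s := 1 - (a * x + b * y)) (by linarith [hz.2]) (by linarith [hz.1])
    have h2 := (hasSum_genFun ρ (s := 1 - x) (by linarith [hx.2]) (by linarith [hx.1])).mul_left a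
    have h3 := (hasSum_genFun ρ (s := 1 - y) (by linarith [hy.2]) (by linarith [hy.1])).mul_left b
    have h4 := hasSum_le (fun k => ?_) h1 (h2.add h3)
    · simp only [smul_eq_mul, gap]
      linear_combination h4 + hab
    · have hk := (convexOn_pow (𝕜 := ℝ) k).2 (x := 1 - x) (by simpa using hx.2) (y := 1 - y)
        (by simpa using hy.2) ha hb hab
      simp only [smul_eq_mul] at hk
      rw [show a * (1 - x) + b * (1 - y) = 1 - (a * x + b * y) by linear_combination hab] at hk
      calc (ρ k).toReal * (1 - (a * x + b * y)) ^ k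
          ≤ (ρ k).toReal * (a * (1 - x) ^ k + b * (1 - y) ^ k) := by gcongr
        _ = _ := by ring
  zero := by
    have : genFun ρ 1 = 1 := by simpa [genFun] using (hasSum_toReal ρ).tsum_eq
    simp [gap, this]
  nonneg v hv0 hv1 := by
    have h1 := hasSum_genFun ρ (s := 1 - v) (by linarith) (by linarith)
    have h2 := (hasSum_toReal ρ).sub ((hasSum_mean hmean).mul_left v)
    have h3 := hasSum_le (fun k => ?_) h2 h1
    · rw [gap]
      linarith
    · have hB := one_add_mul_le_pow (a := -v) (by linarith) k
      calc (ρ k).toReal - v * (k * (ρ k).toReal) = (ρ k).toReal * (1 + k * -v) := by ring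
        _ ≤ (ρ k).toReal * (1 + -v) ^ k := by gcongr
        _ = (ρ k).toReal * (1 - v) ^ k := by rw [sub_eq_add_neg]
  one_lt := by
    have h0 : gap ρ 1 = (ρ 0).toReal := by
      rw [gap, genFun, tsum_eq_single 0]
      · simp
      · intro k hk
        simp [hk]
    rw [h0]
    have hne : ρ 0 ≠ 1 := by
      intro h
      rw [PMF.apply_eq_one_iff] at h
      have : ∀ k : ℕ, (k : ENNReal) * ρ k = 0 := by
        intro k
        rcases Nat.eq_zero_or_pos k with rfl | hk
        · simp
        · rw [(ρ.apply_eq_zero_iff k).2 (by rw [h]; simpa using hk.ne'), mul_zero]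
      simp [this] at hmean
    rw [← ENNReal.toReal_one]
    exact (ENNReal.toReal_lt_toReal (ρ.apply_ne_top 0) ENNReal.one_ne_top).2
      (lt_of_le_of_ne (ρ.coe_le_one 0) hne)

theorem gap_regularVariation {ρ : PMF ℕ} {α : ℝ} (hstable : InStableDomain ρ α) :
    (∀ᶠ x in 𝓝[>] (0 : ℝ), 0 < gap ρ x) ∧ ∀ c : ℝ, 0 < c → c < 1 →
      Tendsto (fun x => gap ρ (c * x) / gap ρ x) (𝓝[>] 0) (𝓝 (c ^ α)) := by
  obtain ⟨L, hL, hf⟩ := hstable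
  have hgap : ∀ v, 0 < v → v ≤ 1 → gap ρ v = v ^ α * L v := by
    intro v hv0 hv1
    have := hf (1 - v) (by linarith) (by linarith)
    rw [gap, genFun, this, sub_sub_cancel]
    ring
  have hev : ∀ᶠ x in 𝓝[>] (0 : ℝ), 0 < x ∧ x < 1 := Ioo_mem_nhdsGT zero_lt_one
  refine ⟨?_, fun c hc0 hc1 => ?_⟩
  · filter_upwards [hev, hL.eventually_pos] with x hx hLx
    rw [hgap x hx.1 hx.2.le]
    exact mul_pos (Real.rpow_pos_of_pos hx.1 _) hLx
  · have h1 := (hL.tendsto c hc0).const_mul (c ^ α)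
    rw [mul_one] at h1
    refine h1.congr' ?_
    filter_upwards [hev] with x hx
    rw [hgap x hx.1 hx.2.le, hgap (c * x) (mul_pos hc0 hx.1) (by nlinarith [hx.1, hx.2]),
      Real.mul_rpow hc0.le hx.1.le]
    have := (Real.rpow_pos_of_pos hx.1 α).ne'
    rw [show c ^ α * x ^ α * L (c * x) = x ^ α * (c ^ α * L (c * x)) by ring,
      mul_div_mul_left _ _ this, mul_div_assoc]

/-! ### Fractional moments through generating functions -/

theorem one_sub_two_mul_pow_add_pow_nonneg {t : ℝ} (h1 : t ≤ 1) (X : ℕ) :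
    0 ≤ 1 - 2 * (1 - t / 2) ^ X + (1 - t) ^ X := by
  have hconv : ConvexOn ℝ (Set.Ici 0) fun x : ℝ => x ^ X := convexOn_pow X
  have h := hconv.2 (x := 1) (by simp) (y := 1 - t) (by simpa using h1)
    (by norm_num : (0 : ℝ) ≤ 1 / 2) (by norm_num : (0 : ℝ) ≤ 1 / 2) (by norm_num)
  simp only [smul_eq_mul, one_pow] at h
  rw [show 1 / 2 * 1 + 1 / 2 * (1 - t) = 1 - t / 2 by ring] at h
  linarith

/-- Take `2 ^ (i + 1) ≤ X < 2 ^ (i + 2)`. At `t = 2^(-i)` one has `t X ≥ 2`, so the bracket is at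
least `1 - 2 * (3 / 8) = 1 / 4`. For `X ≤ 1` the bracket vanishes. -/
theorem exists_rpow_le {r : ℝ} (hr : 0 ≤ r) {X : ℕ} (hX : 2 ≤ X) :
    ∃ i : ℕ, (X : ℝ) ^ r ≤ 4 ^ (r + 1) * ((2 : ℝ) ^ i) ^ r *
      (1 - 2 * (1 - (1 / 2) ^ i / 2) ^ X + (1 - (1 / 2) ^ i) ^ X) := by
  have hlog : 1 ≤ Nat.log 2 X := Nat.log_pos one_lt_two hX
  obtain ⟨i, hi⟩ := Nat.exists_eq_add_of_le' hlog
  have h1 : 2 ^ (i + 1) ≤ X := hi ▸ Nat.pow_log_le_self 2 (by omega)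
  have h2 : X < 2 ^ (i + 2) := by
    have := Nat.lt_pow_succ_log_self one_lt_two X
    rwa [hi] at this
  have h1' : (2 : ℝ) * 2 ^ i ≤ X := by
    have : (2 : ℝ) ^ (i + 1) ≤ X := by exact_mod_cast h1
    rwa [pow_succ'] at this
  have h2' : (X : ℝ) ≤ 4 * 2 ^ i := by
    have : (X : ℝ) ≤ 2 ^ (i + 2) := by exact_mod_cast h2.le
    rw [pow_add] at this
    linarith
  have hti : (1 / 2 : ℝ) ^ i * 2 ^ i = 1 := by rw [← mul_pow]; norm_num
  have ht1 : (1 / 2 : ℝ) ^ i ≤ 1 := pow_le_one₀ (by norm_num) (by norm_num)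
  have ht0 : (0 : ℝ) < (1 / 2 : ℝ) ^ i := by positivity
  refine ⟨i, ?_⟩
  generalize (1 / 2 : ℝ) ^ i = t at *
  have htX : 2 ≤ t * X := by nlinarith
  have hexp : (1 - t / 2) ^ X ≤ Real.exp (-1) := by
    calc (1 - t / 2) ^ X ≤ Real.exp (-(t / 2)) ^ X :=
          pow_le_pow_left₀ (by linarith) (Real.one_sub_le_exp_neg _) X
      _ = Real.exp (-(t * X / 2)) := by rw [← Real.exp_nat_mul]; congr 1; ring
      _ ≤ Real.exp (-1) := Real.exp_le_exp.2 (by linarith)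
  have he : Real.exp (-1) ≤ 3 / 8 := by
    rw [Real.exp_neg, inv_le_comm₀ (Real.exp_pos 1) (by norm_num)]
    linarith [Real.exp_one_gt_d9]
  have hq : (1 : ℝ) / 4 ≤ 1 - 2 * (1 - t / 2) ^ X + (1 - t) ^ X := by
    have : 0 ≤ (1 - t) ^ X := pow_nonneg (by linarith) X
    linarith
  calc (X : ℝ) ^ r ≤ (4 * 2 ^ i) ^ r := Real.rpow_le_rpow (by positivity) h2' hr
    _ = 4 ^ (r + 1) * ((2 : ℝ) ^ i) ^ r * (1 / 4) := by
      rw [Real.mul_rpow (by norm_num) (by positivity), Real.rpow_add_one (by norm_num)]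
      ring
    _ ≤ _ := by gcongr

/-- The brackets are nonnegative, so the suitable scale may be replaced by the sum over all scales;
the value `X = 1`, invisible to them, is paid for by `μ {X ≠ 0}`. -/
theorem lintegral_rpow_le {Ω : Type*} [MeasurableSpace Ω] (μ : Measure Ω) [IsProbabilityMeasure μ]
    {X : Ω → ℕ} (hX : Measurable X) {r : ℝ} (hr : 0 < r) (B : ℕ → ℝ)
    (hB : ∀ i, ∫ ω, (1 - 2 * (1 - (1 / 2) ^ i / 2) ^ X ω + (1 - (1 / 2) ^ i) ^ X ω) ∂μ ≤ B i) :
    ∫⁻ ω, ENNReal.ofReal ((X ω : ℝ) ^ r) ∂μ ≤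
      μ {ω | X ω ≠ 0} + ∑' i, ENNReal.ofReal (4 ^ (r + 1) * ((2 : ℝ) ^ i) ^ r * B i) := by
  let b : ℕ → Ω → ℝ := fun i ω => 1 - 2 * (1 - (1 / 2) ^ i / 2) ^ X ω + (1 - (1 / 2) ^ i) ^ X ω
  have ht1 : ∀ i : ℕ, (1 / 2 : ℝ) ^ i ≤ 1 := fun i => pow_le_one₀ (by norm_num) (by norm_num)
  have ht0 : ∀ i : ℕ, (0 : ℝ) < (1 / 2 : ℝ) ^ i := fun i => by positivity
  have hb0 : ∀ i ω, 0 ≤ b i ω := fun i ω => one_sub_two_mul_pow_add_pow_nonneg (ht1 i) (X ω)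
  have hbm : ∀ i, Measurable (b i) := fun i =>
    (measurable_const.sub ((measurable_const.pow hX).const_mul 2)).add (measurable_const.pow hX)
  have hbi : ∀ i, Integrable (b i) μ := by
    intro i
    refine Integrable.of_bound (hbm i).aestronglyMeasurable 2 (ae_of_all _ fun ω => ?_)
    rw [Real.norm_of_nonneg (hb0 i ω)]
    have h1 : 0 ≤ (1 - (1 / 2 : ℝ) ^ i / 2) ^ X ω := pow_nonneg (by linarith [ht1 i, ht0 i]) _
    have h2 : (1 - (1 / 2 : ℝ) ^ i) ^ X ω ≤ 1 :=
      pow_le_one₀ (by linarith [ht1 i]) (by linarith [ht0 i])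
    simp only [b]
    linarith
  have hS : MeasurableSet {ω | X ω ≠ 0} := hX (MeasurableSet.of_discrete (s := {x | x ≠ 0}))
  have hpt : ∀ ω, ENNReal.ofReal ((X ω : ℝ) ^ r) ≤ {ω | X ω ≠ 0}.indicator 1 ω +
      ∑' i, ENNReal.ofReal (4 ^ (r + 1) * ((2 : ℝ) ^ i) ^ r * b i ω) := by
    intro ω
    rcases lt_or_ge (X ω) 2 with h | h
    · interval_cases hx : X ω
      · simp [Real.zero_rpow hr.ne']
      · rw [Set.indicator_of_mem (by simp [hx])]
        simp
    · obtain ⟨i, hi⟩ := exists_rpow_le hr.le h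
      exact ((ENNReal.ofReal_le_ofReal hi).trans (ENNReal.le_tsum i)).trans le_add_self
  calc ∫⁻ ω, ENNReal.ofReal ((X ω : ℝ) ^ r) ∂μ
      ≤ ∫⁻ ω, ({ω | X ω ≠ 0}.indicator 1 ω +
        ∑' i, ENNReal.ofReal (4 ^ (r + 1) * ((2 : ℝ) ^ i) ^ r * b i ω)) ∂μ := lintegral_mono hpt
    _ = μ {ω | X ω ≠ 0} + ∑' i, ENNReal.ofReal (4 ^ (r + 1) * ((2 : ℝ) ^ i) ^ r * ∫ ω, b i ω ∂μ) := by
      rw [lintegral_add_left (measurable_one.indicator hS), lintegral_indicator_one hS,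
        lintegral_tsum fun i => ((hbm i).const_mul _).ennreal_ofReal.aemeasurable]
      congr 2
      funext i
      rw [← integral_const_mul, ofReal_integral_eq_lintegral_ofReal ((hbi i).const_mul _)]
      exact ae_of_all _ fun ω => mul_nonneg (by positivity) (hb0 i ω)
    _ ≤ _ := by
      gcongr with i
      exact hB i

/-! ### Moments of the generations of the reduced tree -/

theorem integral_bracket_levelCount_le {ρ : PMF ℕ} (hG : IsCriticalGap (gap ρ)) {t : ℝ}
    (h0 : 0 ≤ t) (h1 : t ≤ 1) (m l : ℕ) :
    ∫ k, (1 - 2 * (1 - t / 2) ^ levelCount m (m + l) k + (1 - t) ^ levelCount m (m + l) k)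
      ∂gwLaw ρ ≤ m * gap ρ (t * (coGenFun ρ)^[l] 1) := by
  have hint : ∀ s : ℝ, 0 ≤ s → s ≤ 1 →
      Integrable (fun k => (1 - s) ^ levelCount m (m + l) k) (gwLaw ρ) := by
    intro s hs0 hs1
    refine Integrable.of_bound
      (measurable_const.pow (measurable_levelCount m (m + l))).aestronglyMeasurable 1
      (ae_of_all _ fun k => ?_)
    rw [Real.norm_of_nonneg (pow_nonneg (by linarith) _)]
    exact pow_le_one₀ (by linarith) (by linarith)
  have hi1 := (hint (t / 2) (by linarith) (by linarith)).const_mul 2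
  have hi2 := hint t h0 h1
  rw [integral_add (f := fun k => 1 - 2 * (1 - t / 2) ^ levelCount m (m + l) k)
    ((integrable_const 1).sub hi1) hi2, integral_sub (integrable_const 1) hi1,
    integral_const_mul, integral_pow_levelCount ρ h0 h1,
    integral_pow_levelCount ρ (by linarith) (by linarith), coGenFun_eq, integral_const, probReal_univ]
  obtain ⟨hq0, hq1⟩ := hG.iterate_mem zero_le_one le_rfl l
  generalize (fun v => v - gap ρ v)^[l] (1 : ℝ) = q at *
  have := hG.two_mul_iterate_half_sub_le (u := t * q) (by positivity) (by nlinarith) m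
  rw [show t / 2 * q = t * q / 2 by ring]
  simp only [smul_eq_mul]
  linarith

theorem exists_lintegral_levelCount_rpow_le {ρ : PMF ℕ} {α : ℝ} (hα : 1 < α ∧ α ≤ 2)
    (hmean : ∑' k : ℕ, (k : ENNReal) * ρ k = 1) (hstable : InStableDomain ρ α)
    {r : ℝ} (hr : 0 < r ∧ r < α) :
    ∃ K : ℝ, 0 ≤ K ∧ ∀ m l : ℕ, m ≤ l →
      ∫⁻ k, ENNReal.ofReal ((levelCount m (m + l) k : ℝ) ^ r) ∂gwLaw ρ ≤
        ENNReal.ofReal (K * (coGenFun ρ)^[m + l] 1) := by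
  have hG := isCriticalGap_gap hmean
  obtain ⟨hpos, hreg⟩ := gap_regularVariation hstable
  -- An exponent `s > r` makes the ratio `2 ^ (r - s)` of the sum over scales less than one; `s > 1`
  -- is needed for the orbit estimate.
  obtain ⟨s, hs, hsα⟩ := exists_between (max_lt hα.1 hr.2)
  obtain ⟨hs1, hrs⟩ := max_lt_iff.1 hs
  obtain ⟨δ, hδ0, hδ1, hGδ, hscale⟩ := hG.exists_forall_le_rpow hs1 hsα hpos hreg
  obtain ⟨D, hD0, hD⟩ := hG.exists_nat_mul_le_iterate_add hs1 hδ0 hGδ hscale (hsα.le.trans hα.2)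
  obtain ⟨x, hx⟩ : ∃ x : ℝ, x = 2 ^ (r - s) := ⟨_, rfl⟩
  have hx0 : 0 ≤ x := hx ▸ by positivity
  have hx1 : x < 1 := hx ▸ Real.rpow_lt_one_of_one_lt_of_neg one_lt_two (by linarith)
  have hpow : ∀ i : ℕ, ((2 : ℝ) ^ i) ^ r * ((1 / 2 : ℝ) ^ i) ^ s = x ^ i := by
    intro i
    rw [hx, ← Real.rpow_natCast (2 ^ (r - s)) i, one_div, inv_pow, Real.inv_rpow (by positivity),
      ← Real.rpow_neg (by positivity), ← Real.rpow_add (by positivity), ← Real.rpow_natCast 2 i,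
      ← Real.rpow_mul zero_le_two, ← Real.rpow_mul zero_le_two]
    congr 1
    ring
  obtain ⟨E, hE⟩ : ∃ E : ℝ, E = 4 ^ (r + 1) * (1 / δ) ^ s := ⟨_, rfl⟩
  have hE0 : 0 ≤ E := hE ▸ by positivity
  have hx1' : 0 < 1 - x := by linarith
  refine ⟨1 + E * D / (1 - x), by positivity, fun m l hml => ?_⟩
  obtain ⟨q, hq⟩ : ∃ q, q = (coGenFun ρ)^[l] 1 := ⟨_, rfl⟩
  obtain ⟨p, hp⟩ : ∃ p, p = (coGenFun ρ)^[m + l] 1 := ⟨_, rfl⟩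
  have hq01 : 0 ≤ q ∧ q ≤ 1 := by
    rw [hq, coGenFun_eq]
    exact hG.iterate_mem zero_le_one le_rfl l
  have hp0 : 0 ≤ p := by
    rw [hp, coGenFun_eq]
    exact (hG.iterate_one_pos _).le
  have hDm : m * gap ρ q ≤ D * p := by
    rw [hq, hp, coGenFun_eq]
    exact hD m l hml
  have hmom := lintegral_rpow_le (gwLaw ρ) (measurable_levelCount m (m + l)) hr.1 _ fun i =>
    integral_bracket_levelCount_le hG (t := (1 / 2) ^ i) (by positivity)
      (pow_le_one₀ (by norm_num) (by norm_num)) m l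
  have hterm : ∀ i : ℕ, 4 ^ (r + 1) * ((2 : ℝ) ^ i) ^ r * (m * gap ρ ((1 / 2) ^ i * q)) ≤
      E * D * p * x ^ i := by
    intro i
    have := hG.le_mul_rpow hs1 hδ0 hδ1 hscale (c := (1 / 2) ^ i) (by positivity)
      (pow_le_one₀ (by norm_num) (by norm_num)) hq01.1 hq01.2
    calc 4 ^ (r + 1) * ((2 : ℝ) ^ i) ^ r * (m * gap ρ ((1 / 2) ^ i * q))
        ≤ 4 ^ (r + 1) * ((2 : ℝ) ^ i) ^ r *
          (m * ((1 / δ) ^ s * ((1 / 2) ^ i) ^ s * gap ρ q)) := by gcongr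
      _ = E * (m * gap ρ q) * (((2 : ℝ) ^ i) ^ r * ((1 / 2 : ℝ) ^ i) ^ s) := by rw [hE]; ring
      _ ≤ E * (D * p) * x ^ i := by rw [hpow]; gcongr
      _ = E * D * p * x ^ i := by ring
  have hsurv : gwLaw ρ {k | levelCount m (m + l) k ≠ 0} ≤ ENNReal.ofReal p := by
    rw [hp, ← measure_survives, ofReal_measureReal]
    exact measure_mono fun k hk => mem_survives_of_levelCount_ne_zero hk
  rw [← hq] at hmom
  rw [← hp]
  calc _ ≤ ENNReal.ofReal p + ∑' i : ℕ, ENNReal.ofReal (E * D * p * x ^ i) :=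
        hmom.trans (add_le_add hsurv (ENNReal.tsum_le_tsum fun i =>
          ENNReal.ofReal_le_ofReal (hterm i)))
    _ = ENNReal.ofReal p + ENNReal.ofReal (E * D * p * (1 - x)⁻¹) := by
        rw [← ENNReal.ofReal_tsum_of_nonneg (fun i => by positivity)
          ((summable_geometric_of_lt_one hx0 hx1).mul_left _), tsum_mul_left,
          tsum_geometric_of_lt_one hx0 hx1]
    _ = ENNReal.ofReal ((1 + E * D / (1 - x)) * p) := by
        rw [← ENNReal.ofReal_add hp0 (by positivity)]
        congr 1
        ring

theorem exists_lintegral_conductance_rpow_le {ρ : PMF ℕ} {α : ℝ} (hα : 1 < α ∧ α ≤ 2)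
    (hmean : ∑' k : ℕ, (k : ENNReal) * ρ k = 1) (hstable : InStableDomain ρ α)
    {r : ℝ} (hr : 0 < r ∧ r < α) :
    ∃ K : ℝ, 1 ≤ K ∧ ∀ n : ℕ,
      ∫⁻ k, ENNReal.ofReal (conductance n (reducedTree n k) ^ r) ∂conditionedGWLaw ρ n ≤
        ENNReal.ofReal (K / ((n : ℝ) + 1) ^ r) := by
  obtain ⟨K, hK0, hK⟩ := exists_lintegral_levelCount_rpow_le hα hmean hstable hr
  have hG := isCriticalGap_gap hmean
  refine ⟨max 1 (2 ^ r * K), le_max_left _ _, fun n => ?_⟩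
  -- Splitting near the middle gives both `m ≤ l` and `n + 1 ≤ 2 (m + 1)`, whence the factor `2 ^
  -- r`.
  obtain ⟨m, l, hml, hl, rfl⟩ : ∃ m l, m ≤ l ∧ l ≤ m + 1 ∧ m + l = n :=
    ⟨n / 2, n - n / 2, by omega, by omega, by omega⟩
  have hK := hK m l hml
  obtain ⟨p, hp⟩ : ∃ p, p = (coGenFun ρ)^[m + l] 1 := ⟨_, rfl⟩
  have hp0 : 0 < p := by
    rw [hp, coGenFun_eq]
    exact hG.iterate_one_pos _
  have hS : gwLaw ρ (survives (m + l)) = ENNReal.ofReal p := by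
    rw [hp, ← measure_survives, ofReal_measureReal]
  rw [← hp] at hK
  have hm : (0 : ℝ) < (m : ℝ) + 1 := by positivity
  have hpt : ∀ k, ENNReal.ofReal (conductance (m + l) (reducedTree (m + l) k) ^ r) ≤
      ENNReal.ofReal (1 / ((m : ℝ) + 1) ^ r) *
        ENNReal.ofReal ((levelCount m (m + l) k : ℝ) ^ r) := by
    intro k
    rw [← ENNReal.ofReal_mul (by positivity)]
    refine ENNReal.ofReal_le_ofReal ((Real.rpow_le_rpow
      (conductance_nonneg (finite_reducedTree _ k) _)
      (conductance_reducedTree_le (Nat.le_add_right m l) k) hr.1.le).trans_eq ?_)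
    rw [Real.div_rpow (by positivity) hm.le]
    ring
  rw [conditionedGWLaw, ProbabilityTheory.cond, lintegral_smul_measure, hS, smul_eq_mul]
  calc (ENNReal.ofReal p)⁻¹ * ∫⁻ k in survives (m + l),
        ENNReal.ofReal (conductance (m + l) (reducedTree (m + l) k) ^ r) ∂gwLaw ρ
      ≤ (ENNReal.ofReal p)⁻¹ * ∫⁻ k, ENNReal.ofReal (1 / ((m : ℝ) + 1) ^ r) *
        ENNReal.ofReal ((levelCount m (m + l) k : ℝ) ^ r) ∂gwLaw ρ := by
        refine mul_le_mul_right ?_ _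
        -- The restriction to survival is dropped: the unconditioned moment is already of order `p`.
        exact (setLIntegral_le_lintegral _ _).trans (lintegral_mono hpt)
    _ ≤ (ENNReal.ofReal p)⁻¹ * (ENNReal.ofReal (1 / ((m : ℝ) + 1) ^ r) *
        ENNReal.ofReal (K * p)) := by
        rw [lintegral_const_mul' _ _ ENNReal.ofReal_ne_top]
        gcongr
    _ = ENNReal.ofReal (K / ((m : ℝ) + 1) ^ r) := by
        rw [← ENNReal.ofReal_inv_of_pos hp0, ← ENNReal.ofReal_mul (by positivity),
          ← ENNReal.ofReal_mul (by positivity)]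
        congr 1
        field_simp
    _ ≤ _ := by
        refine ENNReal.ofReal_le_ofReal ?_
        have h2 : (((m + l : ℕ) : ℝ) + 1) ^ r ≤ 2 ^ r * ((m : ℝ) + 1) ^ r := by
          rw [← Real.mul_rpow zero_le_two hm.le]
          refine Real.rpow_le_rpow (by positivity) ?_ hr.1.le
          have : (l : ℝ) ≤ m + 1 := by exact_mod_cast hl
          push_cast
          linarith
        rw [div_le_div_iff₀ (by positivity) (by positivity)]
        calc K * (((m + l : ℕ) : ℝ) + 1) ^ r ≤ K * (2 ^ r * ((m : ℝ) + 1) ^ r) := by gcongr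
          _ = 2 ^ r * K * ((m : ℝ) + 1) ^ r := by ring
          _ ≤ max 1 (2 ^ r * K) * ((m : ℝ) + 1) ^ r := by
            gcongr
            exact le_max_right _ _

end ReducedGW

theorem mainTheorem11 (ρ : PMF ℕ) (α : ℝ) (hα : 1 < α ∧ α ≤ 2)
    (hnontrivial : ρ ≠ PMF.pure 1)
    (hmean : ∑' k : ℕ, (k : ENNReal) * ρ k = 1)
    (hstable : ReducedGW.InStableDomain ρ α)
    (r : ℝ) (hr : 0 < r ∧ r < α) :
    ∃ K : ℝ, 1 ≤ K ∧ ∀ n : ℕ, 1 ≤ n →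
      MeasureTheory.Integrable
          (fun k => ReducedGW.conductance n (ReducedGW.reducedTree n k) ^ r)
          (ReducedGW.conditionedGWLaw ρ n) ∧
        ∫ k, ReducedGW.conductance n (ReducedGW.reducedTree n k) ^ r
            ∂(ReducedGW.conditionedGWLaw ρ n) ≤ K / ((n : ℝ) + 1) ^ r := by
  obtain ⟨K, hK1, hK⟩ := ReducedGW.exists_lintegral_conductance_rpow_le hα hmean hstable hr
  refine ⟨K, hK1, fun n _ => ?_⟩
  have hmeas : Measurable fun k => ReducedGW.conductance n (ReducedGW.reducedTree n k) ^ r :=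
    (ReducedGW.measurable_conductance n).pow_const r
  have hnn : 0 ≤ᵐ[ReducedGW.conditionedGWLaw ρ n]
      fun k => ReducedGW.conductance n (ReducedGW.reducedTree n k) ^ r :=
    ae_of_all _ fun k => Real.rpow_nonneg
      (ReducedGW.conductance_nonneg (ReducedGW.finite_reducedTree n k) n) r
  -- The finite bound on the lower integral yields both integrability and the bound on the
  -- expectation.
  refine ⟨⟨hmeas.aestronglyMeasurable, ?_⟩, ?_⟩
  · rw [hasFiniteIntegral_iff_ofReal hnn]
    exact (hK n).trans_lt ENNReal.ofReal_lt_top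
  · rw [integral_eq_lintegral_of_nonneg_ae hnn hmeas.aestronglyMeasurable]
    exact ENNReal.toReal_le_of_le_ofReal (by positivity) (hK n)
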